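/- Let $\Bbbk$ be an algebraically closed field of characteristic $0$ and let $p\ge 1$. Let ${\rm Y}={\rm Y}_p(\mathfrak{gl}_2)$ be the Yangian of level $p$: the associative unital $\Bbbk$-algebra with generators $t_{ij}^{(1)},\dots,t_{ij}^{(p)}$, $i,j\in\{1,2\}$, and defining relations $$(u-v)\,[T_{ij}(u),T_{kl}(v)]=T_{kj}(u)T_{il}(v)-T_{kj}(v)T_{il}(u),\qquad T_{ij}(u)=\delta_{ij}u^p+\sum_{r=1}^p t_{ij}^{(r)}u^{p-r}.$$ Let $D(u)=T_{11}(u)T_{22}(u-1)-T_{21}(u)T_{12}(u-1)$ be the quantum determinant, and let $\Gamma\subseteq{\rm Y}$ be the subalgebra generated by the coefficients of $D(u)$ and by $t_{22}^{(1)},\dots,t_{22}^{(p)}$. Let $\mathbb L$ be the localization of $\Bbbk[b_1,\dots,b_p,g_1,\dots,g_{2p}]$ at the multiplicative set generated by all $b_i-b_j-m$ with $i\ne j$ and $m\in\mathbb Z$, and put $\gamma(u)=\prod_{j=1}^{2p}(u+g_j)$. Let $\delta_1,\dots,\delta_p$ be the standard basis of $\mathbb Z^p$. The universal representation $\mathrm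 G$ of ${\rm Y}$ assigns to $x\in{\rm Y}$ the matrix, with rows and columns indexed by $\mathbb Z^p$ and entries in $\mathbb L$, of the action of $x$ on the free $\mathbb L$-module with basis $\xi^{(k)}$, $k\in\mathbb Z^p$, given by $$T_{22}(u)\,\xi^{(k)}=\prod_{j=1}^p(u+b_j+k_j)\,\xi^{(k)},$$ $$T_{21}(u)\,\xi^{(k)}=\sum_{i=1}^pA_i(k)\prod_{j\ne i}\frac{u+b_j+k_j}{b_j-b_i+k_j-k_i}\,\xi^{(k+\delta_i)},\qquad T_{12}(u)\,\xi^{(k)}=\sum_{i=1}^pB_i(k)\prod_{j\ne i}\frac{u+b_j+k_j}{b_j-b_i+k_j-k_i}\,\xi^{(k-\delta_i)},$$ where $A_i(k)=1$ if $k_i\ge0$ and $A_i(k)=-\gamma(-b_i-k_i)$ if $k_i<0$, while $B_i(k)=-\gamma(-b_i-k_i+1)$ if $k_i>0$ and $B_i(k)=1$ if $k_i\le0$; the action of $T_{11}(u)$ is determined by $\bigl(T_{11}(u)T_{22}(u-1)-T_{21}(u)T_{12}(u-1)\bigr)\xi^{(k)}=\gamma(u)\,\xi^{(k)}$. Then: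 1. $\Gamma$ is a maximal commutative subalgebra of ${\rm Y}_p(\mathfrak{gl}_2)$. 2. The representation $\mathrm G$ is faithful, and if $x\in{\rm Y}_p(\mathfrak{gl}_2)$ is such that the matrix $\mathrm G(x)$ is diagonal, then $x\in\Gamma$. -/

import Mathlib

open Polynomial

noncomputable section

namespace LevelYangian

/-! ## The level `p` Yangian of `gl_2`

The indices `1, 2` of `gl_2` are the elements `0, 1` of `Fin 2`. -/

/-- The free generator `t_{ij}^{(r)}`, with the conventions `t_{ij}^{(0)} = δ_{ij}` and
`t_{ij}^{(r)} = 0` for `r > p`. -/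
def freeGen (K : Type*) [Field K] (p : ℕ) (i j : Fin 2) :
    ℕ → FreeAlgebra K (Fin 2 × Fin 2 × Fin p)
  | 0 => if i = j then 1 else 0
  | r + 1 => if h : r < p then FreeAlgebra.ι K (i, j, ⟨r, h⟩) else 0

/-- The defining relations: the coefficients of `u^(p-r) v^(p-s)` on both sides of
`(u - v) [T_{ij}(u), T_{kl}(v)] = T_{kj}(u) T_{il}(v) - T_{kj}(v) T_{il}(u)`, where
`T_{ij}(u) = ∑_{r=0}^{p} t_{ij}^{(r)} u^(p-r)`. -/
inductive Rel (K : Type*) [Field K] (p : ℕ) :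
    FreeAlgebra K (Fin 2 × Fin 2 × Fin p) → FreeAlgebra K (Fin 2 × Fin 2 × Fin p) → Prop
  | rtt (i j k l : Fin 2) (r s : ℕ) : Rel K p
      (⁅freeGen K p i j (r + 1), freeGen K p k l s⁆ - ⁅freeGen K p i j r, freeGen K p k l (s + 1)⁆)
      (freeGen K p k j r * freeGen K p i l s - freeGen K p k j s * freeGen K p i l r)

/-- The Yangian of level `p` of `gl_2`. -/
abbrev Yangian (K : Type*) [Field K] (p : ℕ) : Type _ := RingQuot (Rel K p)

/-- The element `t_{ij}^{(r)}` of the Yangian of level `p`. -/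
def t (K : Type*) [Field K] (p : ℕ) (i j : Fin 2) (r : ℕ) : Yangian K p :=
  RingQuot.mkAlgHom K (Rel K p) (freeGen K p i j r)

/-- The polynomial `T_{ij}(u) = δ_{ij} u^p + ∑_{r=1}^{p} t_{ij}^{(r)} u^(p-r)`. -/
def T (K : Type*) [Field K] (p : ℕ) (i j : Fin 2) : (Yangian K p)[X] :=
  ∑ r ∈ Finset.range (p + 1), C (t K p i j r) * X ^ (p - r)

/-- The quantum determinant `D(u) = T_{11}(u) T_{22}(u-1) - T_{21}(u) T_{12}(u-1)`. -/
def qdet (K : Type*) [Field K] (p : ℕ) : (Yangian K p)[X] :=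
  T K p 0 0 * (T K p 1 1).comp (X - 1) - T K p 1 0 * (T K p 0 1).comp (X - 1)

/-- The subalgebra `Γ` generated by the coefficients of `D(u)` and by the `t_{22}^{(r)}`,
`1 ≤ r ≤ p`. -/
def Gamma (K : Type*) [Field K] (p : ℕ) : Subalgebra K (Yangian K p) :=
  Algebra.adjoin K
    (Set.range (fun n : ℕ => (qdet K p).coeff n) ∪ {x | ∃ r : ℕ, 1 ≤ r ∧ r ≤ p ∧ x = t K p 1 1 r})

theorem t_rel (K : Type*) [Field K] (p : ℕ) (i j k l : Fin 2) (r s : ℕ) :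
    ⁅t K p i j (r + 1), t K p k l s⁆ - ⁅t K p i j r, t K p k l (s + 1)⁆ =
      t K p k j r * t K p i l s - t K p k j s * t K p i l r := by
  have h := RingQuot.mkAlgHom_rel K (Rel.rtt (K := K) (p := p) i j k l r s)
  have hsub : ∀ a b : FreeAlgebra K (Fin 2 × Fin 2 × Fin p), RingQuot.mkAlgHom K (Rel K p) (a - b) =
      RingQuot.mkAlgHom K (Rel K p) a - RingQuot.mkAlgHom K (Rel K p) b := fun a b =>
    eq_sub_of_add_eq ((map_add _ (a - b) b).symm.trans (congrArg _ (sub_add_cancel a b)))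
  simp only [Ring.lie_def, t] at h ⊢
  rw [hsub, hsub, hsub, hsub] at h
  simp only [map_mul] at h
  exact h

/-! ## The matrices of the generators

`R` is a commutative ring with elements `b_1, …, b_p, g_1, …, g_{2p}`. A matrix with rows and
columns indexed by the lattice `ℤ^p` is an endomorphism of the free module with basis `ξ^(k)`,
`k ∈ ℤ^p`; here `ξ^(k)` is `Finsupp.single k 1`, and the vector `δ_i` is `Pi.single i 1`. -/

section ops
variable {R : Type*} [CommRing R] {p : ℕ}

/-- Column-finite `ℤ^p × ℤ^p` matrices over `R`. -/
abbrev LatticeEnd (R : Type*) [CommRing R] (p : ℕ) : Type _ := Module.End R ((Fin p → ℤ) →₀ R)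

/-- `b_i + k_i`. -/
def wt (b : Fin p → R) (k : Fin p → ℤ) (i : Fin p) : R := b i + (k i : R)

/-- `γ(u) = (u + g_1) ⋯ (u + g_{2p})`. -/
def gammaVal (g : Fin (2 * p) → R) (u : R) : R := ∏ j, (u + g j)

/-- `A_i(k)`: it is `1` for `k_i ≥ 0` and `-γ(-b_i-k_i)` for `k_i < 0`. -/
def coeffA (b : Fin p → R) (g : Fin (2 * p) → R) (k : Fin p → ℤ) (i : Fin p) : R :=
  if 0 ≤ k i then 1 else -gammaVal g (-wt b k i)

/-- `B_i(k)`: it is `-γ(-b_i-k_i+1)` for `k_i > 0` and `1` for `k_i ≤ 0`. -/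
def coeffB (b : Fin p → R) (g : Fin (2 * p) → R) (k : Fin p → ℤ) (i : Fin p) : R :=
  if k i ≤ 0 then 1 else -gammaVal g (-wt b k i + 1)

/-- `∏_j (u + b_j + k_j)`. -/
def betaPoly (b : Fin p → R) (k : Fin p → ℤ) : R[X] := ∏ j, (X + C (wt b k j))

/-- `∏_{j ≠ i} (u + b_j + k_j) / (b_j - b_i + k_j - k_i)`; the denominators are units in the
coefficient ring to which this is applied. -/
def lagrangePoly (b : Fin p → R) (k : Fin p → ℤ) (i : Fin p) : R[X] :=
  ∏ j ∈ Finset.univ.erase i, C (Ring.inverse (wt b k j - wt b k i)) * (X + C (wt b k j))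

/-- `t_{22}^{(r)}`, the coefficient of `u^(p-r)` in
`T_{22}(u) ξ^(k) = ∏_j (u + b_j + k_j) ξ^(k)`. -/
def op22 (b : Fin p → R) (r : ℕ) : LatticeEnd R p :=
  Finsupp.linearCombination R fun k => Finsupp.single k ((betaPoly b k).coeff (p - r))

/-- `t_{21}^{(r)}`, the coefficient of `u^(p-r)` in `T_{21}(u) ξ^(k) =
∑_i A_i(k) ∏_{j ≠ i} (u + b_j + k_j) / (b_j - b_i + k_j - k_i) ξ^(k+δ_i)`. -/
def op21 (b : Fin p → R) (g : Fin (2 * p) → R) (r : ℕ) : LatticeEnd R p :=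
  Finsupp.linearCombination R fun k => ∑ i,
    Finsupp.single (k + Pi.single i 1) (coeffA b g k i * (lagrangePoly b k i).coeff (p - r))

/-- `t_{12}^{(r)}`, the coefficient of `u^(p-r)` in `T_{12}(u) ξ^(k) =
∑_i B_i(k) ∏_{j ≠ i} (u + b_j + k_j) / (b_j - b_i + k_j - k_i) ξ^(k-δ_i)`. -/
def op12 (b : Fin p → R) (g : Fin (2 * p) → R) (r : ℕ) : LatticeEnd R p :=
  Finsupp.linearCombination R fun k => ∑ i,
    Finsupp.single (k - Pi.single i 1) (coeffB b g k i * (lagrangePoly b k i).coeff (p - r))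

/-- `t_{11}^{(r)}`, from the defining relation `[t_{12}^{(1)}, t_{21}^{(r)}] = t_{11}^{(r)} -
t_{22}^{(r)}`. This is the unique solution of the equation
`(T_{11}(u) T_{22}(u-1) - T_{21}(u) T_{12}(u-1)) ξ^(k) = γ(u) ξ^(k)`; see `opT_qdet`. -/
def op11 (b : Fin p → R) (g : Fin (2 * p) → R) (r : ℕ) : LatticeEnd R p :=
  op22 b r + ⁅op12 b g 1, op21 b g r⁆

/-- The matrix of `t_{ij}^{(r)}`. -/
def opT (b : Fin p → R) (g : Fin (2 * p) → R) (i j : Fin 2) (r : ℕ) : LatticeEnd R p :=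
  if p < r then 0 else !![op11 b g r, op12 b g r; op21 b g r, op22 b r] i j

/-! ### The matrices satisfy the defining relations

The lemmas from here to `opT_rel` serve only to prove that. -/

theorem rel_of_core {A : Type*} [Ring A]
    (tf : ∀ (n : ℤ) (x : A), n ≠ 0 → n • x = 0 → x = 0)
    (T11 T12 T21 T22 γ : ℤ → A) (a e : A)
    (hreg : ∀ (u : ℤ) (x : A), x * T22 u = 0 → x = 0)
    (h2222 : ∀ u v, T22 u * T22 v = T22 v * T22 u)
    (h2121 : ∀ u v, T21 u * T21 v = T21 v * T21 u)
    (h1212 : ∀ u v, T12 u * T12 v = T12 v * T12 u)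
    (h2122 : ∀ u v, (u - v) • ⁅T21 u, T22 v⁆ = T21 u * T22 v - T21 v * T22 u)
    (h2221 : ∀ u v, (u - v) • ⁅T22 u, T21 v⁆ = T22 u * T21 v - T22 v * T21 u)
    (h1222 : ∀ u v, (u - v) • ⁅T12 u, T22 v⁆ = T22 u * T12 v - T22 v * T12 u)
    (h2212 : ∀ u v, (u - v) • ⁅T22 u, T12 v⁆ = T12 u * T22 v - T12 v * T22 u)
    (h1221 : ∀ u v, (u - v) • ⁅T12 u, T21 v⁆ = T22 u * T11 v - T22 v * T11 u)
    (ha22 : ∀ v, ⁅a, T22 v⁆ = T12 v) (ha12 : ∀ v, ⁅a, T12 v⁆ = 0)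
    (ha21 : ∀ v, ⁅a, T21 v⁆ = T11 v - T22 v)
    (he12 : ∀ v, ⁅T12 v, e⁆ = T11 v - T22 v) (he22 : ∀ v, ⁅T22 v, e⁆ = T21 v)
    (he21 : ∀ v, ⁅T21 v, e⁆ = 0)
    (hγa : ∀ u, a * γ u = γ u * a) (hγe : ∀ u, γ u * e = e * γ u)
    (hq : ∀ u, T11 u * T22 (u - 1) - T21 u * T12 (u - 1) = γ u)
    (i j k l : Fin 2) (u v : ℤ) :
    (u - v) • ⁅(!![T11, T12; T21, T22] i j) u, (!![T11, T12; T21, T22] k l) v⁆ =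
      (!![T11, T12; T21, T22] k j) u * (!![T11, T12; T21, T22] i l) v -
      (!![T11, T12; T21, T22] k j) v * (!![T11, T12; T21, T22] i l) u := by
  simp only [Ring.lie_def] at *
  have hz1 : ∀ (n : ℤ) (x y : A), x * (n • y) = n • (x * y) := fun n x y => by
    simp only [zsmul_eq_mul, ← mul_assoc, (Int.cast_commute n x).eq]
  have hz2 : ∀ (n : ℤ) (x y : A), (n • x) * y = n • (x * y) := fun n x y => by
    simp only [zsmul_eq_mul, mul_assoc]
  -- 11,22
  have hC : ∀ u v, (u - v) • (T11 u * T22 v - T22 v * T11 u) = T21 u * T12 v - T21 v * T12 u := by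
    intro u v
    by_cases huv : u = v
    · subst huv; simp
    have key : ∀ u v : ℤ, (u - v) • (T11 u * T22 v - T22 v * T11 u) =
        (T11 u * T22 v - T22 v * T11 u) - (T11 v * T22 u - T22 u * T11 v) +
          (T21 u * T12 v - T21 v * T12 u) := by
      intro u v
      have e1 : T11 u * T22 v - T22 v * T11 u =
          (a * (T21 u * T22 v - T22 v * T21 u) - (T21 u * T22 v - T22 v * T21 u) * a)
          - (T21 u * T12 v - T12 v * T21 u) := by
        have h1 : T11 u = T22 u + (a * T21 u - T21 u * a) := by rw [ha21]; abel
        rw [h1, ← ha22 v]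
        have := h2222 u v
        simp only [mul_sub, sub_mul, mul_add, add_mul, mul_assoc] at *
        rw [this]; abel
      have e2 : (u - v) • (T21 u * T12 v - T12 v * T21 u) = T22 v * T11 u - T22 u * T11 v := by
        rw [← h1221 v u, ← neg_sub v u, neg_smul, ← smul_neg]; congr 1; abel
      have e3 : (u - v) • (a * (T21 u * T22 v - T22 v * T21 u)
          - (T21 u * T22 v - T22 v * T21 u) * a) =
          a * (T21 u * T22 v - T21 v * T22 u) - (T21 u * T22 v - T21 v * T22 u) * a := by
        rw [← h2122 u v, hz1, hz2, ← smul_sub]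
      rw [e1, smul_sub, e2, e3, ← e1]
      have p1 : ∀ u v, a * (T21 u * T22 v) - T21 u * T22 v * a =
          (T11 u - T22 u) * T22 v + T21 u * T12 v := by
        intro u v; rw [← ha21, ← ha22]; noncomm_ring
      have : a * (T21 u * T22 v - T21 v * T22 u) - (T21 u * T22 v - T21 v * T22 u) * a =
        (a * (T21 u * T22 v) - T21 u * T22 v * a) - (a * (T21 v * T22 u) - T21 v * T22 u * a) := by
        noncomm_ring
      rw [this, p1, p1, sub_mul, sub_mul, h2222 v u]; abel
    have k1 := key u v
    have k2 := key v u
    set c := T11 u * T22 v - T22 v * T11 u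
    set d := T11 v * T22 u - T22 u * T11 v
    have hd : d = c - (u - v) • c + (T21 u * T12 v - T21 v * T12 u) := by rw [k1]; abel
    rw [hd] at k2
    refine sub_eq_zero.mp (tf (u - v) _ (sub_ne_zero.mpr huv) ?_)
    rw [← sub_eq_zero] at k2
    rw [← k2]
    module
  have flip : ∀ (P Q : ℤ → A) (X : ℤ → ℤ → A), (∀ u v, X v u = - X u v) →
      (∀ u v, (u - v) • (P u * Q v - Q v * P u) = X u v) →
      ∀ u v, P u * Q v - Q v * P u = P v * Q u - Q u * P v := by
    intro P Q X hX h u v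
    by_cases huv : u = v
    · subst huv; rfl
    refine sub_eq_zero.mp (tf (u - v) _ (sub_ne_zero.mpr huv) ?_)
    have h1 := h u v
    have h2 := h v u
    rw [hX u v] at h2
    rw [smul_sub, h1, ← neg_sub v u, neg_smul, h2]; abel
  have sw : ∀ (P Q : ℤ → A) (u v : ℤ), (u - v) • (P u * Q v - Q v * P u) =
      (v - u) • (Q v * P u - P u * Q v) := by
    intro P Q u v
    module
  have h1122f := flip T11 T22 (fun u v => T21 u * T12 v - T21 v * T12 u) (by intros; abel) hC
  have h1221f := flip T12 T21 _ (by intros; abel) h1221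
  have h2112 : ∀ u v, (u - v) • (T21 u * T12 v - T12 v * T21 u) =
      T11 u * T22 v - T11 v * T22 u := by
    intro u v
    rw [sw, h1221]
    have := h1122f u v
    linear_combination (norm := noncomm_ring) -this
  have h2211 : ∀ u v, (u - v) • (T22 u * T11 v - T11 v * T22 u) =
      T12 u * T21 v - T12 v * T21 u := by
    intro u v
    rw [sw, hC]
    have := h1221f u v
    linear_combination (norm := noncomm_ring) -this
  have ha11 : ∀ u, a * T11 u - T11 u * a = - T12 u := by
    intro u
    rw [← sub_eq_zero]
    apply hreg (u - 1)
    have h1 := h1222 u (u - 1)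
    have h2 := hγa u
    rw [← hq] at h2
    have h3 := ha22 (u - 1)
    have h4 := ha21 u
    have h5 := ha12 (u - 1)
    rw [show u - (u - 1) = 1 by ring, one_smul] at h1
    generalize u - 1 = w at *
    linear_combination (norm := noncomm_ring) h2 - T11 u * h3 + h4 * T12 w + T21 u * h5 + h1
  have hq2 : ∀ u, T11 (u - 1) * T22 u - T12 (u - 1) * T21 u = γ u := by
    intro u
    rw [← hq]
    have h1 := hC (u - 1) u
    have h2 := hC u (u - 1)
    have h3 := h1221 (u - 1) u
    rw [show u - 1 - u = -1 by ring, neg_smul, one_smul] at h1 h3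
    rw [show u - (u - 1) = 1 by ring, one_smul] at h2
    generalize u - 1 = w at *
    linear_combination (norm := noncomm_ring) h3 - h1 - h2
  have he11 : ∀ u, T11 u * e - e * T11 u = - T21 u := by
    intro u
    rw [← sub_eq_zero]
    apply hreg (u + 1)
    have h1 := h2221 (u + 1) u
    have h2 := hγe (u + 1)
    rw [← hq2, add_sub_cancel_right] at h2
    have h3 := he22 (u + 1)
    have h4 := he12 u
    have h5 := he21 (u + 1)
    rw [add_sub_cancel_left, one_smul] at h1
    have h6 := h2122 u (u + 1)
    rw [show u - (u + 1) = - 1 by ring, neg_smul, one_smul] at h6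
    generalize u + 1 = w at *
    linear_combination (norm := noncomm_ring) h2 - T11 u * h3 + h4 * T21 w + T12 u * h5 - h1
  have h1211 : ∀ u v, (u - v) • (T12 u * T11 v - T11 v * T12 u) =
      T12 u * T11 v - T12 v * T11 u := by
    intro u v
    have h1 : T12 u * T11 v - T11 v * T12 u = (T12 u * T22 v - T22 v * T12 u) +
        (a * (T12 u * T21 v - T21 v * T12 u) - (T12 u * T21 v - T21 v * T12 u) * a) := by
      linear_combination (norm := noncomm_ring) - T12 u * ha21 v + ha21 v * T12 u
        - ha12 u * T21 v + T21 v * ha12 u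
    rw [h1, smul_add, h1222, smul_sub, ← hz1, ← hz2, h1221]
    linear_combination (norm := noncomm_ring) ha22 u * T11 v + T22 u * ha11 v - ha22 v * T11 u
      - T22 v * ha11 u
  have h2111 : ∀ u v, (u - v) • (T21 u * T11 v - T11 v * T21 u) =
      T11 u * T21 v - T11 v * T21 u := by
    intro u v
    have h1 : T21 u * T11 v - T11 v * T21 u = (T21 u * T22 v - T22 v * T21 u) +
        ((T21 u * T12 v - T12 v * T21 u) * e - e * (T21 u * T12 v - T12 v * T21 u)) := by
      linear_combination (norm := noncomm_ring) - T21 u * he12 v + he12 v * T21 u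
        - he21 u * T12 v + T12 v * he21 u
    rw [h1, smul_add, h2122, smul_sub, ← hz2 _ _ e, ← hz1 _ e, h2112]
    linear_combination (norm := noncomm_ring) he11 u * T22 v + T11 u * he22 v - he11 v * T22 u
      - T11 v * he22 u
  have h1211f := flip T12 T11 _ (by intros; abel) h1211
  have h2111f := flip T21 T11 _ (by intros; abel) h2111
  have h1112 : ∀ u v, (u - v) • (T11 u * T12 v - T12 v * T11 u) =
      T11 u * T12 v - T11 v * T12 u := by
    intro u v
    rw [sw, h1211]
    have := h1211f u v
    linear_combination (norm := noncomm_ring) -this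
  have h1121 : ∀ u v, (u - v) • (T11 u * T21 v - T21 v * T11 u) =
      T21 u * T11 v - T21 v * T11 u := by
    intro u v
    rw [sw, h2111]
    have := h2111f u v
    linear_combination (norm := noncomm_ring) -this
  have h1111 : ∀ u v, T11 u * T11 v = T11 v * T11 u := by
    have key : ∀ u v : ℤ, (u - v) • (T11 u * T11 v - T11 v * T11 u) =
        T11 u * T11 v - T11 v * T11 u := by
      intro u v
      have h1 : T11 u * T11 v - T11 v * T11 u = (T11 u * T22 v - T22 v * T11 u) +
          (a * (T11 u * T21 v - T21 v * T11 u) - (T11 u * T21 v - T21 v * T11 u) * a) +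
          (T12 u * T21 v - T21 v * T12 u) := by
        linear_combination (norm := noncomm_ring) - T11 u * ha21 v + ha21 v * T11 u
          - ha11 u * T21 v + T21 v * ha11 u
      rw [h1, smul_add, smul_add, hC, smul_sub, ← hz1, ← hz2, h1121, h1221, ← h1]
      linear_combination (norm := noncomm_ring) ha21 u * T11 v + T21 u * ha11 v
        - ha21 v * T11 u - T21 v * ha11 u
    have key2 : ∀ u v : ℤ, u - v ≠ 1 → T11 u * T11 v = T11 v * T11 u := by
      intro u v h
      refine sub_eq_zero.mp (tf (u - v - 1) _ (sub_ne_zero.mpr h) ?_)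
      rw [sub_smul, key, one_smul, sub_self]
    intro u v
    by_cases h : u - v = 1
    · exact (key2 v u (by omega)).symm
    · exact key2 u v h
  fin_cases i <;> fin_cases j <;> fin_cases k <;> fin_cases l <;>
    simp only [Matrix.of_apply, Matrix.cons_val', Matrix.cons_val_zero, Matrix.cons_val_one,
      Matrix.cons_val_fin_one, Fin.zero_eta, Fin.mk_one, Fin.isValue, hC, h2112, h2211, h1211, h2111, h1112, h1121, h2122, h2221, h1222, h2212, h1221]
  · simp [h1111 u v]
  · simp [h1212 u v]
  · simp [h2121 u v]
  · simp [h2222 u v]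



def lam (b : Fin p → R) (k : Fin p → ℤ) (i : Fin p) : R :=
  ∏ j ∈ Finset.univ.erase i, Ring.inverse (wt b k j - wt b k i)

def prd (b : Fin p → R) (k : Fin p → ℤ) (S : Finset (Fin p)) (u s : R) : R :=
  ∏ j ∈ S, (u + s * wt b k j)

def diagOp (x : (Fin p → ℤ) → R) : LatticeEnd R p :=
  Finsupp.linearCombination R fun k => Finsupp.single k (x k)

def upOp (x : (Fin p → ℤ) → Fin p → R) : LatticeEnd R p :=
  Finsupp.linearCombination R fun k => ∑ i, Finsupp.single (k + Pi.single i 1) (x k i)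

def downOp (x : (Fin p → ℤ) → Fin p → R) : LatticeEnd R p :=
  Finsupp.linearCombination R fun k => ∑ i, Finsupp.single (k - Pi.single i 1) (x k i)

def midOp (x : (Fin p → ℤ) → Fin p → Fin p → R) : LatticeEnd R p :=
  Finsupp.linearCombination R fun k => ∑ i, ∑ j,
    Finsupp.single (k + Pi.single i 1 - Pi.single j 1) (x k i j)

theorem end_ext {f f' : LatticeEnd R p}
    (h : ∀ k, f (Finsupp.single k 1) = f' (Finsupp.single k 1)) : f = f' :=
  Finsupp.lhom_ext' fun k => LinearMap.ext_ring (h k)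

theorem diagOp_single (x : (Fin p → ℤ) → R) (k : Fin p → ℤ) (c : R) :
    diagOp x (Finsupp.single k c) = Finsupp.single k (c * x k) := by
  simp [diagOp]

theorem upOp_single (x : (Fin p → ℤ) → Fin p → R) (k : Fin p → ℤ) (c : R) :
    upOp x (Finsupp.single k c) = ∑ i, Finsupp.single (k + Pi.single i 1) (c * x k i) := by
  simp [upOp, Finset.smul_sum]

theorem downOp_single (x : (Fin p → ℤ) → Fin p → R) (k : Fin p → ℤ) (c : R) :
    downOp x (Finsupp.single k c) = ∑ i, Finsupp.single (k - Pi.single i 1) (c * x k i) := by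
  simp [downOp, Finset.smul_sum]

theorem midOp_single (x : (Fin p → ℤ) → Fin p → Fin p → R) (k : Fin p → ℤ) (c : R) :
    midOp x (Finsupp.single k c) =
      ∑ i, ∑ j, Finsupp.single (k + Pi.single i 1 - Pi.single j 1) (c * x k i j) := by
  simp [midOp, Finset.smul_sum]

theorem down_mul_up (x y : (Fin p → ℤ) → Fin p → R) :
    downOp x * upOp y = midOp fun k i j => y k i * x (k + Pi.single i 1) j := by
  apply end_ext; intro k
  simp [upOp_single, downOp_single, midOp_single]

theorem up_mul_down (x y : (Fin p → ℤ) → Fin p → R) :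
    upOp x * downOp y = midOp fun k i j => y k j * x (k - Pi.single j 1) i := by
  apply end_ext; intro k
  simp only [Module.End.mul_apply, upOp_single, downOp_single, midOp_single, map_sum, one_mul]
  rw [Finset.sum_comm]
  simp only [sub_add_eq_add_sub]

theorem diag_mul_up (x : (Fin p → ℤ) → R) (y : (Fin p → ℤ) → Fin p → R) :
    diagOp x * upOp y = upOp fun k i => y k i * x (k + Pi.single i 1) := by
  apply end_ext; intro k
  simp [upOp_single, diagOp_single]

theorem up_mul_diag (x : (Fin p → ℤ) → R) (y : (Fin p → ℤ) → Fin p → R) :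
    upOp y * diagOp x = upOp fun k i => x k * y k i := by
  apply end_ext; intro k
  simp [upOp_single, diagOp_single]

theorem diag_mul_down (x : (Fin p → ℤ) → R) (y : (Fin p → ℤ) → Fin p → R) :
    diagOp x * downOp y = downOp fun k i => y k i * x (k - Pi.single i 1) := by
  apply end_ext; intro k
  simp [downOp_single, diagOp_single]

theorem down_mul_diag (x : (Fin p → ℤ) → R) (y : (Fin p → ℤ) → Fin p → R) :
    downOp y * diagOp x = downOp fun k i => x k * y k i := by
  apply end_ext; intro k
  simp [downOp_single, diagOp_single]

theorem diag_mul_mid (x : (Fin p → ℤ) → R) (y : (Fin p → ℤ) → Fin p → Fin p → R) :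
    diagOp x * midOp y = midOp fun k i j => y k i j * x (k + Pi.single i 1 - Pi.single j 1) := by
  apply end_ext; intro k
  simp [midOp_single, diagOp_single]

theorem mid_mul_diag (x : (Fin p → ℤ) → R) (y : (Fin p → ℤ) → Fin p → Fin p → R) :
    midOp y * diagOp x = midOp fun k i j => x k * y k i j := by
  apply end_ext; intro k
  simp [midOp_single, diagOp_single]

theorem diag_mul_diag (x y : (Fin p → ℤ) → R) :
    diagOp x * diagOp y = diagOp fun k => x k * y k := by
  apply end_ext; intro k
  simp [diagOp_single, mul_comm]

theorem upOp_sub (x y : (Fin p → ℤ) → Fin p → R) :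
    upOp x - upOp y = upOp fun k i => x k i - y k i := by
  apply end_ext; intro k
  simp [upOp_single, Finset.sum_sub_distrib]

theorem downOp_sub (x y : (Fin p → ℤ) → Fin p → R) :
    downOp x - downOp y = downOp fun k i => x k i - y k i := by
  apply end_ext; intro k
  simp [downOp_single, Finset.sum_sub_distrib]

theorem midOp_sub (x y : (Fin p → ℤ) → Fin p → Fin p → R) :
    midOp x - midOp y = midOp fun k i j => x k i j - y k i j := by
  apply end_ext; intro k
  simp [midOp_single, Finset.sum_sub_distrib]

theorem upOp_zsmul (n : ℤ) (x : (Fin p → ℤ) → Fin p → R) :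
    n • upOp x = upOp fun k i => n * x k i := by
  apply end_ext; intro k
  simp [upOp_single, Finset.smul_sum]

theorem downOp_zsmul (n : ℤ) (x : (Fin p → ℤ) → Fin p → R) :
    n • downOp x = downOp fun k i => n * x k i := by
  apply end_ext; intro k
  simp [downOp_single, Finset.smul_sum]

theorem midOp_zsmul (n : ℤ) (x : (Fin p → ℤ) → Fin p → Fin p → R) :
    n • midOp x = midOp fun k i j => n * x k i j := by
  apply end_ext; intro k
  simp [midOp_single, Finset.smul_sum]

theorem wt_add_self (b : Fin p → R) (k : Fin p → ℤ) (i : Fin p) :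
    wt b (k + Pi.single i 1) i = wt b k i + 1 := by simp [wt, add_assoc]

theorem wt_add_ne (b : Fin p → R) (k : Fin p → ℤ) {i j : Fin p} (h : j ≠ i) :
    wt b (k + Pi.single i 1) j = wt b k j := by simp [wt, h]

theorem wt_sub_self (b : Fin p → R) (k : Fin p → ℤ) (i : Fin p) :
    wt b (k - Pi.single i 1) i = wt b k i - 1 := by simp [wt, add_sub_assoc]

theorem wt_sub_ne (b : Fin p → R) (k : Fin p → ℤ) {i j : Fin p} (h : j ≠ i) :
    wt b (k - Pi.single i 1) j = wt b k j := by simp [wt, h]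

theorem prd_congr (b : Fin p → R) {k k' : Fin p → ℤ} (S : Finset (Fin p)) (u s : R)
    (h : ∀ j ∈ S, wt b k j = wt b k' j) : prd b k S u s = prd b k' S u s :=
  Finset.prod_congr rfl fun j hj => by rw [h j hj]

theorem prd_univ (b : Fin p → R) (k : Fin p → ℤ) (i : Fin p) (u s : R) :
    prd b k Finset.univ u s = (u + s * wt b k i) * prd b k (Finset.univ.erase i) u s :=
  (Finset.mul_prod_erase Finset.univ (fun j => u + s * wt b k j) (Finset.mem_univ i)).symm

theorem prd_erase (b : Fin p → R) (k : Fin p → ℤ) {i j : Fin p} (h : j ≠ i) (u s : R) :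
    prd b k (Finset.univ.erase i) u s =
      (u + s * wt b k j) * prd b k ((Finset.univ.erase i).erase j) u s :=
  (Finset.mul_prod_erase _ (fun j => u + s * wt b k j) (by simp [h])).symm

theorem prd_zero (b : Fin p → R) (k : Fin p → ℤ) (S : Finset (Fin p)) :
    prd b k S 1 0 = 1 := by simp [prd]

theorem prd_add_self (b : Fin p → R) (k : Fin p → ℤ) (i : Fin p) (u s : R) :
    prd b (k + Pi.single i 1) (Finset.univ.erase i) u s = prd b k (Finset.univ.erase i) u s :=
  prd_congr _ _ _ _ fun _ hj => wt_add_ne b k (Finset.ne_of_mem_erase hj)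

theorem prd_sub_self (b : Fin p → R) (k : Fin p → ℤ) (i : Fin p) (u s : R) :
    prd b (k - Pi.single i 1) (Finset.univ.erase i) u s = prd b k (Finset.univ.erase i) u s :=
  prd_congr _ _ _ _ fun _ hj => wt_sub_ne b k (Finset.ne_of_mem_erase hj)

theorem prd_add_ne (b : Fin p → R) (k : Fin p → ℤ) {i j : Fin p} (h : j ≠ i) (u s : R) :
    prd b (k + Pi.single i 1) (Finset.univ.erase j) u s =
      (u + s * (wt b k i + 1)) * prd b k ((Finset.univ.erase i).erase j) u s := by
  rw [prd_erase b _ h.symm, wt_add_self, Finset.erase_right_comm]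
  congr 1
  refine prd_congr _ _ _ _ fun l hl => wt_add_ne b k ?_
  simp at hl; tauto

theorem prd_sub_ne (b : Fin p → R) (k : Fin p → ℤ) {i j : Fin p} (h : j ≠ i) (u s : R) :
    prd b (k - Pi.single i 1) (Finset.univ.erase j) u s =
      (u + s * (wt b k i - 1)) * prd b k ((Finset.univ.erase i).erase j) u s := by
  rw [prd_erase b _ h.symm, wt_sub_self, Finset.erase_right_comm]
  congr 1
  refine prd_congr _ _ _ _ fun l hl => wt_sub_ne b k ?_
  simp at hl; tauto

def E22 (b : Fin p → R) (u s : R) : LatticeEnd R p :=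
  diagOp fun k => prd b k Finset.univ u s

def E21 (b : Fin p → R) (g : Fin (2 * p) → R) (u s : R) : LatticeEnd R p :=
  upOp fun k i => coeffA b g k i * lam b k i * prd b k (Finset.univ.erase i) u s

def E12 (b : Fin p → R) (g : Fin (2 * p) → R) (u s : R) : LatticeEnd R p :=
  downOp fun k i => coeffB b g k i * lam b k i * prd b k (Finset.univ.erase i) u s

theorem lie_swap {A : Type*} [Ring A] (x y : A) : ⁅x, y⁆ = -⁅y, x⁆ := by
  simp [Ring.lie_def]

theorem aux_sub {A : Type*} [Ring A] {x y a c : A} (h : x * y = y * x) :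
    x * c - y * a = x * (c - y) - y * (a - x) := by
  rw [mul_sub, mul_sub, h]; abel

theorem aux_add {A : Type*} [Ring A] (x y a z : A) :
    a * y - z = x * y + ((a - x) * y - z) := by
  rw [sub_mul]; abel

theorem lie_22_21 (b : Fin p → R) (g : Fin (2 * p) → R) (u s v s' : R) :
    ⁅E22 b u s, E21 b g v s'⁆ = upOp fun k i => s * (coeffA b g k i * lam b k i *
      prd b k (Finset.univ.erase i) u s * prd b k (Finset.univ.erase i) v s') := by
  rw [Ring.lie_def, E22, E21, diag_mul_up, up_mul_diag, upOp_sub]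
  congr 1; funext k i
  rw [prd_univ b _ i, prd_univ b k i, prd_add_self, wt_add_self]; ring

theorem lie_12_22 (b : Fin p → R) (g : Fin (2 * p) → R) (u s v s' : R) :
    ⁅E12 b g v s', E22 b u s⁆ = downOp fun k i => s * (coeffB b g k i * lam b k i *
      prd b k (Finset.univ.erase i) u s * prd b k (Finset.univ.erase i) v s') := by
  rw [Ring.lie_def, E22, E12, diag_mul_down, down_mul_diag, downOp_sub]
  congr 1; funext k i
  rw [prd_univ b (k - Pi.single i 1) i, prd_univ b k i, prd_sub_self, wt_sub_self]; ring

theorem rel_22_21 (b : Fin p → R) (g : Fin (2 * p) → R) (u v : ℤ) :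
    (u - v) • ⁅E22 b (u : R) 1, E21 b g (v : R) 1⁆ =
      E22 b (u : R) 1 * E21 b g (v : R) 1 - E22 b (v : R) 1 * E21 b g (u : R) 1 := by
  rw [lie_22_21, E22, E22, E21, E21, diag_mul_up, diag_mul_up, upOp_sub, upOp_zsmul]
  congr 1; funext k i
  rw [prd_univ b _ i, prd_univ b _ i, prd_add_self, prd_add_self, wt_add_self]
  push_cast; ring

theorem rel_21_22 (b : Fin p → R) (g : Fin (2 * p) → R) (u v : ℤ) :
    (u - v) • ⁅E21 b g (u : R) 1, E22 b (v : R) 1⁆ =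
      E21 b g (u : R) 1 * E22 b (v : R) 1 - E21 b g (v : R) 1 * E22 b (u : R) 1 := by
  rw [lie_swap, lie_22_21, E22, E22, E21, E21, up_mul_diag, up_mul_diag, upOp_sub, smul_neg,
    ← neg_smul, upOp_zsmul]
  congr 1; funext k i
  rw [prd_univ b _ i, prd_univ b _ i]
  push_cast; ring

theorem rel_12_22 (b : Fin p → R) (g : Fin (2 * p) → R) (u v : ℤ) :
    (u - v) • ⁅E12 b g (u : R) 1, E22 b (v : R) 1⁆ =
      E22 b (u : R) 1 * E12 b g (v : R) 1 - E22 b (v : R) 1 * E12 b g (u : R) 1 := by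
  rw [lie_12_22, E22, E22, E12, E12, diag_mul_down, diag_mul_down, downOp_sub, downOp_zsmul]
  congr 1; funext k i
  rw [prd_univ b _ i, prd_univ b _ i, prd_sub_self, prd_sub_self, wt_sub_self]
  push_cast; ring

theorem rel_22_12 (b : Fin p → R) (g : Fin (2 * p) → R) (u v : ℤ) :
    (u - v) • ⁅E22 b (u : R) 1, E12 b g (v : R) 1⁆ =
      E12 b g (u : R) 1 * E22 b (v : R) 1 - E12 b g (v : R) 1 * E22 b (u : R) 1 := by
  rw [lie_swap, lie_12_22, E22, E22, E12, E12, down_mul_diag, down_mul_diag, downOp_sub,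
    smul_neg, ← neg_smul, downOp_zsmul]
  congr 1; funext k i
  rw [prd_univ b _ i, prd_univ b _ i]
  push_cast; ring

/-- all differences of weights are units -/
def Generic (b : Fin p → R) : Prop := ∀ i j, i ≠ j → ∀ m : ℤ, IsUnit (b i - b j + m)

theorem inv_neg' (x : R) : Ring.inverse (-x) = - Ring.inverse x := by
  by_cases h : IsUnit x
  · obtain ⟨y, rfl⟩ := h
    rw [← Units.val_neg, Ring.inverse_unit, Ring.inverse_unit, inv_neg, Units.val_neg]
  · rw [Ring.inverse_non_unit _ h, Ring.inverse_non_unit _ (by rwa [IsUnit.neg_iff]), neg_zero]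

theorem Generic.inv {b : Fin p → R} (hb : Generic b) {i j : Fin p} (h : i ≠ j) (k : Fin p → ℤ)
    (m : ℤ) : (wt b k i - wt b k j + m) * Ring.inverse (wt b k i - wt b k j + m) = 1 := by
  apply Ring.mul_inverse_cancel
  have e : wt b k i - wt b k j + m = b i - b j + ((k i - k j + m : ℤ) : R) := by
    simp only [wt]; push_cast; ring
  rw [e]
  exact hb i j h _

def lam2 (b : Fin p → R) (k : Fin p → ℤ) (i j : Fin p) : R :=
  ∏ l ∈ (Finset.univ.erase i).erase j, Ring.inverse (wt b k l - wt b k i)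

theorem lam_eq (b : Fin p → R) (k : Fin p → ℤ) {i j : Fin p} (h : j ≠ i) :
    lam b k i = Ring.inverse (wt b k j - wt b k i) * lam2 b k i j :=
  (Finset.mul_prod_erase _ (fun l => Ring.inverse (wt b k l - wt b k i)) (by simp [h])).symm

theorem lam_add (b : Fin p → R) (k : Fin p → ℤ) {i j : Fin p} (h : j ≠ i) :
    lam b (k + Pi.single i 1) j = Ring.inverse (wt b k i + 1 - wt b k j) * lam2 b k j i := by
  rw [lam_eq b _ h.symm, wt_add_self, wt_add_ne b k h]
  congr 1
  refine Finset.prod_congr rfl fun l hl => ?_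
  rw [wt_add_ne b k h, wt_add_ne b k]
  simp at hl; tauto

theorem lam_sub (b : Fin p → R) (k : Fin p → ℤ) {i j : Fin p} (h : j ≠ i) :
    lam b (k - Pi.single i 1) j = Ring.inverse (wt b k i - 1 - wt b k j) * lam2 b k j i := by
  rw [lam_eq b _ h.symm, wt_sub_self, wt_sub_ne b k h]
  congr 1
  refine Finset.prod_congr rfl fun l hl => ?_
  rw [wt_sub_ne b k h, wt_sub_ne b k]
  simp at hl; tauto

theorem coeffA_add (b : Fin p → R) (g : Fin (2 * p) → R) (k : Fin p → ℤ) {i j : Fin p}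
    (h : j ≠ i) : coeffA b g (k + Pi.single i 1) j = coeffA b g k j := by
  simp [coeffA, wt_add_ne b k h, h]

theorem coeffA_sub (b : Fin p → R) (g : Fin (2 * p) → R) (k : Fin p → ℤ) {i j : Fin p}
    (h : j ≠ i) : coeffA b g (k - Pi.single i 1) j = coeffA b g k j := by
  simp [coeffA, wt_sub_ne b k h, h]

theorem coeffB_add (b : Fin p → R) (g : Fin (2 * p) → R) (k : Fin p → ℤ) {i j : Fin p}
    (h : j ≠ i) : coeffB b g (k + Pi.single i 1) j = coeffB b g k j := by
  simp [coeffB, wt_add_ne b k h, h]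

theorem coeffB_sub (b : Fin p → R) (g : Fin (2 * p) → R) (k : Fin p → ℤ) {i j : Fin p}
    (h : j ≠ i) : coeffB b g (k - Pi.single i 1) j = coeffB b g k j := by
  simp [coeffB, wt_sub_ne b k h, h]

theorem coeffAB (b : Fin p → R) (g : Fin (2 * p) → R) (k : Fin p → ℤ) (i : Fin p) :
    coeffA b g k i * coeffB b g (k + Pi.single i 1) i = - gammaVal g (-wt b k i) := by
  unfold coeffA coeffB
  rw [wt_add_self]
  have : (k + Pi.single i 1 : Fin p → ℤ) i = k i + 1 := by simp
  rw [this]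
  by_cases h : 0 ≤ k i
  · rw [if_pos h, if_neg (by omega)]; ring_nf
  · rw [if_neg h, if_pos (by omega), mul_one]

theorem coeffBA (b : Fin p → R) (g : Fin (2 * p) → R) (k : Fin p → ℤ) (i : Fin p) :
    coeffB b g k i * coeffA b g (k - Pi.single i 1) i = - gammaVal g (-wt b k i + 1) := by
  unfold coeffA coeffB
  rw [wt_sub_self]
  have : (k - Pi.single i 1 : Fin p → ℤ) i = k i - 1 := by simp
  rw [this]
  by_cases h : k i ≤ 0
  · rw [if_pos h, if_neg (by omega)]; ring_nf
  · rw [if_neg h, if_pos (by omega), mul_one]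

theorem antisym_sum {M : Type*} [AddCommGroup M] (tf : ∀ x : M, x + x = 0 → x = 0)
    (G : Fin p → Fin p → M) (h : ∀ i j, G i j = - G j i) : ∑ i, ∑ j, G i j = 0 := by
  apply tf
  nth_rw 2 [Finset.sum_comm]
  rw [← Finset.sum_add_distrib]
  refine Finset.sum_eq_zero fun i _ => ?_
  rw [← Finset.sum_add_distrib]
  refine Finset.sum_eq_zero fun j _ => ?_
  rw [h i j]; simp

theorem comm_21 [IsDomain R] [CharZero R] {b : Fin p → R} (hb : Generic b)
    (g : Fin (2 * p) → R) (u s v s' : R) :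
    E21 b g u s * E21 b g v s' = E21 b g v s' * E21 b g u s := by
  apply end_ext; intro k
  rw [← sub_eq_zero]
  simp only [E21, Module.End.mul_apply, upOp_single, map_sum, one_mul, ← Finset.sum_sub_distrib,
    ← Finsupp.single_sub]
  apply antisym_sum
  · intro x hx
    ext k'
    have := DFunLike.congr_fun hx k'
    simpa [← two_mul] using this
  intro i j
  by_cases hij : i = j
  · subst hij
    rw [← Finsupp.single_neg]
    congr 1
    rw [prd_add_self, prd_add_self]; ring
  · have hji : j ≠ i := fun h => hij h.symm
    rw [add_right_comm, ← Finsupp.single_neg]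
    congr 1
    rw [prd_add_ne b k hji, prd_add_ne b k hij, prd_add_ne b k hji, prd_add_ne b k hij,
      prd_erase b k hji, prd_erase b k hij, prd_erase b k hji, prd_erase b k hij,
      coeffA_add b g k hji, coeffA_add b g k hij, lam_add b k hji, lam_add b k hij,
      lam_eq b k hij, lam_eq b k hji, Finset.erase_right_comm (a := j) (b := i)]
    have e1 := hb.inv hij k 1
    have e2 := hb.inv hji k 1
    have hinv : Ring.inverse (wt b k i - wt b k j) = - Ring.inverse (wt b k j - wt b k i) := by
      rw [← inv_neg', neg_sub]
    rw [Int.cast_one] at e1 e2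
    rw [show wt b k i + 1 - wt b k j = wt b k i - wt b k j + 1 by ring,
      show wt b k j + 1 - wt b k i = wt b k j - wt b k i + 1 by ring,
      hinv]
    linear_combination (coeffA b g k i * coeffA b g k j * lam2 b k i j * lam2 b k j i *
      prd b k ((Finset.univ.erase i).erase j) u s * prd b k ((Finset.univ.erase i).erase j) v s' *
      Ring.inverse (wt b k j - wt b k i) * (s * v - u * s')) * (e1 - e2)


theorem comm_12 [IsDomain R] [CharZero R] {b : Fin p → R} (hb : Generic b)
    (g : Fin (2 * p) → R) (u s v s' : R) :
    E12 b g u s * E12 b g v s' = E12 b g v s' * E12 b g u s := by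
  apply end_ext; intro k
  rw [← sub_eq_zero]
  simp only [E12, Module.End.mul_apply, downOp_single, map_sum, one_mul, ← Finset.sum_sub_distrib,
    ← Finsupp.single_sub]
  apply antisym_sum
  · intro x hx
    ext k'
    have := DFunLike.congr_fun hx k'
    simpa [← two_mul] using this
  intro i j
  by_cases hij : i = j
  · subst hij
    rw [← Finsupp.single_neg]
    congr 1
    rw [prd_sub_self, prd_sub_self]; ring
  · have hji : j ≠ i := fun h => hij h.symm
    rw [sub_right_comm, ← Finsupp.single_neg]
    congr 1
    rw [prd_sub_ne b k hji, prd_sub_ne b k hij, prd_sub_ne b k hji, prd_sub_ne b k hij,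
      prd_erase b k hji, prd_erase b k hij, prd_erase b k hji, prd_erase b k hij,
      coeffB_sub b g k hji, coeffB_sub b g k hij, lam_sub b k hji, lam_sub b k hij,
      lam_eq b k hij, lam_eq b k hji, Finset.erase_right_comm (a := j) (b := i)]
    have e1 := hb.inv hij k 1
    have e2 := hb.inv hji k 1
    have hinv : Ring.inverse (wt b k i - wt b k j) = - Ring.inverse (wt b k j - wt b k i) := by
      rw [← inv_neg', neg_sub]
    rw [Int.cast_one] at e1 e2
    rw [show wt b k i - 1 - wt b k j = -(wt b k j - wt b k i + 1) by ring,
      show wt b k j - 1 - wt b k i = -(wt b k i - wt b k j + 1) by ring, hinv, inv_neg', inv_neg']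
    linear_combination (coeffB b g k i * coeffB b g k j * lam2 b k i j * lam2 b k j i *
      prd b k ((Finset.univ.erase i).erase j) u s * prd b k ((Finset.univ.erase i).erase j) v s' *
      Ring.inverse (wt b k j - wt b k i) * (s * v - u * s')) * (e2 - e1)

def hc (b : Fin p → R) (g : Fin (2 * p) → R) (k : Fin p → ℤ) (i j : Fin p) : R :=
  if i = j then
    coeffA b g k i * coeffB b g (k + Pi.single i 1) i * lam b k i * lam b (k + Pi.single i 1) i -
    coeffB b g k i * coeffA b g (k - Pi.single i 1) i * lam b k i * lam b (k - Pi.single i 1) i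
  else coeffA b g k i * coeffB b g k j * lam b k i * lam b (k + Pi.single i 1) j

def E11 (b : Fin p → R) (g : Fin (2 * p) → R) (u : R) : LatticeEnd R p :=
  E22 b u 1 + midOp fun k i j => hc b g k i j * prd b k ((Finset.univ.erase i).erase j) u 1

theorem lie_12_21 (b : Fin p → R) (g : Fin (2 * p) → R) (u s v s' : R) :
    ⁅E12 b g u s, E21 b g v s'⁆ = midOp fun k i j => hc b g k i j *
      prd b k ((Finset.univ.erase i).erase j) u s * prd b k ((Finset.univ.erase i).erase j) v s' *
      (if i = j then 1 else s * (v + s' * wt b k j) + s' * (u + s * wt b k i)) := by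
  rw [Ring.lie_def, E12, E21, down_mul_up, up_mul_down, midOp_sub]
  congr 1; funext k i j
  by_cases hij : i = j
  · subst hij
    rw [prd_add_self, prd_sub_self, hc, if_pos rfl, if_pos rfl, Finset.erase_idem]; ring
  · have hji : j ≠ i := fun h => hij h.symm
    rw [if_neg hij, hc, if_neg hij, prd_add_ne b k hji, prd_sub_ne b k hij, prd_erase b k hij,
      prd_erase b k hji, coeffB_add b g k hji, coeffA_sub b g k hij, lam_add b k hji,
      lam_sub b k hij, lam_eq b k hij, lam_eq b k hji, Finset.erase_right_comm (a := j) (b := i)]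
    have hinv : Ring.inverse (wt b k i - wt b k j) = - Ring.inverse (wt b k j - wt b k i) := by
      rw [← inv_neg', neg_sub]
    rw [show wt b k i + 1 - wt b k j = wt b k i - wt b k j + 1 by ring,
      show wt b k j - 1 - wt b k i = -(wt b k i - wt b k j + 1) by ring, hinv, inv_neg']
    ring

theorem E11_sub (b : Fin p → R) (g : Fin (2 * p) → R) (u : R) : E11 b g u - E22 b u 1 =
    midOp fun k i j => hc b g k i j * prd b k ((Finset.univ.erase i).erase j) u 1 := by
  rw [E11]; abel

theorem lie_a_21 (b : Fin p → R) (g : Fin (2 * p) → R) (v : R) :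
    ⁅E12 b g 1 0, E21 b g v 1⁆ = E11 b g v - E22 b v 1 := by
  rw [lie_12_21, E11_sub]
  congr 1; funext k i j
  rw [prd_zero]; split_ifs <;> ring

theorem lie_12_e (b : Fin p → R) (g : Fin (2 * p) → R) (v : R) :
    ⁅E12 b g v 1, E21 b g 1 0⁆ = E11 b g v - E22 b v 1 := by
  rw [lie_12_21, E11_sub]
  congr 1; funext k i j
  rw [prd_zero]; split_ifs <;> ring

theorem lie_a_22 (b : Fin p → R) (g : Fin (2 * p) → R) (v : R) :
    ⁅E12 b g 1 0, E22 b v 1⁆ = E12 b g v 1 := by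
  rw [lie_12_22, E12]
  congr 1; funext k i
  rw [prd_zero]; ring

theorem lie_22_e (b : Fin p → R) (g : Fin (2 * p) → R) (v : R) :
    ⁅E22 b v 1, E21 b g 1 0⁆ = E21 b g v 1 := by
  rw [lie_22_21, E21]
  congr 1; funext k i
  rw [prd_zero]; ring

theorem comm_22 (b : Fin p → R) (u v : R) : E22 b u 1 * E22 b v 1 = E22 b v 1 * E22 b u 1 := by
  rw [E22, E22, diag_mul_diag, diag_mul_diag]
  congr 1; funext k; ring

theorem prd_shift (b : Fin p → R) (k : Fin p → ℤ) (i j : Fin p) (u : R) :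
    prd b (k + Pi.single i 1 - Pi.single j 1) Finset.univ u 1 =
      prd b k ((Finset.univ.erase i).erase j) u 1 *
      (if i = j then u + wt b k i else (u + wt b k i + 1) * (u + wt b k j - 1)) := by
  by_cases hij : i = j
  · subst hij
    rw [add_sub_cancel_right, prd_univ b k i, if_pos rfl, Finset.erase_idem]; ring
  · have hji : j ≠ i := fun h => hij h.symm
    rw [if_neg hij, prd_univ b _ j, prd_sub_self, prd_add_ne b k hji, wt_sub_self,
      wt_add_ne b k hji]
    ring

theorem rel_12_21 (b : Fin p → R) (g : Fin (2 * p) → R) (u v : ℤ) :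
    (u - v) • ⁅E12 b g (u : R) 1, E21 b g (v : R) 1⁆ =
      E22 b (u : R) 1 * E11 b g (v : R) - E22 b (v : R) 1 * E11 b g (u : R) := by
  have e : E22 b (u : R) 1 * E11 b g (v : R) - E22 b (v : R) 1 * E11 b g (u : R) =
      E22 b (u : R) 1 * (E11 b g (v : R) - E22 b (v : R) 1) -
      E22 b (v : R) 1 * (E11 b g (u : R) - E22 b (u : R) 1) := by
    exact aux_sub (A := LatticeEnd R p) (comm_22 b (u : R) (v : R))
  rw [e, E11_sub, E11_sub, lie_12_21, E22, E22,
    diag_mul_mid, diag_mul_mid, midOp_sub, midOp_zsmul]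
  congr 1; funext k i j
  rw [prd_shift, prd_shift]
  push_cast
  by_cases hij : i = j
  · subst hij; simp only [if_true]; ring
  · simp only [if_neg hij]; ring

theorem midOp_diag (x : (Fin p → ℤ) → Fin p → Fin p → R) (h : ∀ k i j, i ≠ j → x k i j = 0) :
    midOp x = diagOp fun k => ∑ i, x k i i := by
  apply end_ext; intro k
  rw [midOp_single, diagOp_single, one_mul, ← Finsupp.singleAddHom_apply, map_sum]
  simp only [Finsupp.singleAddHom_apply]
  refine Finset.sum_congr rfl fun i _ => ?_
  rw [Finset.sum_eq_single i, add_sub_cancel_right, one_mul]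
  · intro j _ hj; rw [h k i j hj.symm]; simp
  · simp

theorem lagrange_id [IsDomain R] (c : Fin p → R) (h : ∀ i j, i ≠ j → ∀ m : ℤ, c i - c j + m ≠ 0)
    (g : Fin (2 * p) → R) (l m : Fin p → R)
    (hl : ∀ i, l i * (∏ j ∈ Finset.univ.erase i, (c j - c i)) *
      (∏ j ∈ Finset.univ.erase i, (c j - c i + 1)) = 1)
    (hm : ∀ i, m i * (∏ j ∈ Finset.univ.erase i, (c j - c i)) *
      (∏ j ∈ Finset.univ.erase i, (c j - c i - 1)) = 1) (u : R) :
    (∏ j, (u + c j)) * (∏ j, (u - 1 + c j)) + ∑ i,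
      (∏ j ∈ Finset.univ.erase i, (u + c j)) * (∏ j ∈ Finset.univ.erase i, (u - 1 + c j)) *
      ((u + c i) * (gammaVal g (-c i + 1) * l i) - (u - 1 + c i) * (gammaVal g (-c i) * m i)) =
    gammaVal g u := by
  let P : R[X] := (∏ j, (X + C (c j))) * (∏ j, (X + C (c j - 1)))
  let Q : Fin p → R[X] := fun i =>
      (∏ j ∈ Finset.univ.erase i, (X + C (c j))) * (∏ j ∈ Finset.univ.erase i, (X + C (c j - 1))) *
      ((X + C (c i)) * C (gammaVal g (-c i + 1) * l i) -
        (X + C (c i - 1)) * C (gammaVal g (-c i) * m i))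
  let G : R[X] := ∏ j, (X + C (g j))
  have hG : ∀ x, G.eval x = gammaVal g x := fun x => by simp [G, eval_prod, gammaVal]
  have hP : ∀ x, P.eval x = (∏ j, (x + c j)) * (∏ j, (x - 1 + c j)) := fun x => by
    simp only [P, eval_mul, eval_prod, eval_add, eval_X, eval_C]
    congr 1; refine Finset.prod_congr rfl fun j _ => ?_; ring
  have hQ : ∀ i x, (Q i).eval x = (∏ j ∈ Finset.univ.erase i, (x + c j)) *
      (∏ j ∈ Finset.univ.erase i, (x - 1 + c j)) *
      ((x + c i) * (gammaVal g (-c i + 1) * l i) -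
        (x - 1 + c i) * (gammaVal g (-c i) * m i)) := fun i x => by
    simp only [Q, eval_mul, eval_prod, eval_add, eval_X, eval_C, eval_sub]
    congr 1
    · congr 1; refine Finset.prod_congr rfl fun j _ => ?_; ring
    · ring
  suffices hPG : P + ∑ i, Q i = G by
    rw [← hG, ← hPG, eval_add, eval_finsetSum, hP]
    simp only [hQ]
  let pt : Fin p ⊕ Fin p → R := Sum.elim (fun i => - c i) (fun i => - c i + 1)
  have hc : ∀ i j, c i = c j → i = j := fun i j hh => by
    by_contra hne; exact h i j hne 0 (by simp [hh])
  have hpt : Function.Injective pt := by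
    rintro (i | i) (j | j) hh
    · rw [hc i j (by simpa [pt] using hh)]
    · exfalso
      by_cases hij : i = j
      · subst hij; simp [pt] at hh
      · apply h i j hij 1; simp [pt] at hh; push_cast; linear_combination -hh
    · exfalso
      by_cases hij : i = j
      · subst hij; simp [pt] at hh
      · apply h i j hij (-1); simp [pt] at hh; push_cast; linear_combination -hh
    · rw [hc i j (by simpa [pt] using hh)]
  refine Polynomial.eq_of_degree_sub_lt_of_eval_index_eq (v := pt) Finset.univ hpt.injOn ?_ ?_
  · have hcard : ((Finset.univ : Finset (Fin p ⊕ Fin p)).card : WithBot ℕ) = ((2 * p : ℕ) : WithBot ℕ) := by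
      simp [two_mul]
    rw [hcard, add_sub_right_comm]
    have hPm : P.Monic := (monic_prod_of_monic _ _ fun j _ => monic_X_add_C _).mul
      (monic_prod_of_monic _ _ fun j _ => monic_X_add_C _)
    have hGm : G.Monic := monic_prod_of_monic _ _ fun j _ => monic_X_add_C _
    have hPd : P.degree = ((2 * p : ℕ) : WithBot ℕ) := by
      rw [degree_eq_natDegree hPm.ne_zero, Monic.natDegree_mul
        (monic_prod_of_monic _ _ fun j _ => monic_X_add_C _)
        (monic_prod_of_monic _ _ fun j _ => monic_X_add_C _),
        natDegree_prod_of_monic _ _ (fun j _ => monic_X_add_C _),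
        natDegree_prod_of_monic _ _ (fun j _ => monic_X_add_C _)]
      simp only [natDegree_X_add_C]
      simp [two_mul]
    have hGd : G.degree = ((2 * p : ℕ) : WithBot ℕ) := by
      rw [degree_eq_natDegree hGm.ne_zero,
        natDegree_prod_of_monic _ _ (fun j _ => monic_X_add_C _)]
      simp
    refine (degree_add_le _ _).trans_lt (max_lt ?_ ?_)
    · rw [← hPd]
      exact degree_sub_lt_left (hPd.trans hGd.symm) hPm.ne_zero (by rw [hPm, hGm])
    · refine (degree_sum_le _ _).trans_lt ((Finset.sup_lt_iff (WithBot.bot_lt_coe _)).mpr ?_)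
      intro i _
      have hpp : 0 < p := i.pos
      have hN : ∀ d : Fin p → R, (∏ j ∈ Finset.univ.erase i, (X + C (d j))).natDegree ≤ p - 1 := by
        intro d
        rw [natDegree_prod_of_monic _ _ (fun j _ => monic_X_add_C _)]
        simp
      refine degree_le_natDegree.trans_lt (Nat.cast_lt.mpr ?_)
      have h1 : ((X + C (c i)) * C (gammaVal g (-c i + 1) * l i) -
        (X + C (c i - 1)) * C (gammaVal g (-c i) * m i)).natDegree ≤ 1 := by
        compute_degree
      have h2 := natDegree_mul_le_of_le (natDegree_mul_le_of_le (hN c) (hN (fun j => c j - 1))) h1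
      refine lt_of_le_of_lt h2 ?_
      omega
  · rintro (i | i) -
    · rw [hG, eval_add, eval_finsetSum, hP, Finset.sum_eq_single i]
      · rw [hQ, Finset.prod_eq_zero (Finset.mem_univ i) (by simp [pt])]
        have := hm i
        have e1 : ∏ j ∈ Finset.univ.erase i, (pt (Sum.inl i) + c j) =
            ∏ j ∈ Finset.univ.erase i, (c j - c i) :=
          Finset.prod_congr rfl fun j _ => by simp [pt]; ring
        have e2 : ∏ j ∈ Finset.univ.erase i, (pt (Sum.inl i) - 1 + c j) =
            ∏ j ∈ Finset.univ.erase i, (c j - c i - 1) :=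
          Finset.prod_congr rfl fun j _ => by simp [pt]; ring
        rw [e1, e2]
        simp only [pt, Sum.elim_inl]
        linear_combination (gammaVal g (-c i)) * this
      · intro j _ hj
        rw [hQ, Finset.prod_eq_zero (i := i) (s := Finset.univ.erase j) (by simp [hj.symm])
          (by simp [pt])]
        ring
      · simp
    · rw [hG, eval_add, eval_finsetSum, hP, Finset.sum_eq_single i]
      · rw [hQ, Finset.prod_eq_zero (f := fun j => pt (Sum.inr i) - 1 + c j)
          (Finset.mem_univ i) (by simp [pt])]
        have := hl i
        have e1 : ∏ j ∈ Finset.univ.erase i, (pt (Sum.inr i) + c j) =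
            ∏ j ∈ Finset.univ.erase i, (c j - c i + 1) :=
          Finset.prod_congr rfl fun j _ => by simp [pt]; ring
        have e2 : ∏ j ∈ Finset.univ.erase i, (pt (Sum.inr i) - 1 + c j) =
            ∏ j ∈ Finset.univ.erase i, (c j - c i) :=
          Finset.prod_congr rfl fun j _ => by simp [pt]; ring
        rw [e1, e2]
        simp only [pt, Sum.elim_inr]
        linear_combination (gammaVal g (-c i + 1)) * this
      · intro j _ hj
        rw [hQ, Finset.prod_eq_zero (f := fun j => pt (Sum.inr i) - 1 + c j) (i := i)
          (s := Finset.univ.erase j) (by simp [hj.symm]) (by simp [pt])]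
        ring
      · simp

theorem lam_cancel {b : Fin p → R} (hb : Generic b) (k : Fin p → ℤ) (i : Fin p) :
    lam b k i * ∏ j ∈ Finset.univ.erase i, (wt b k j - wt b k i) = 1 := by
  rw [lam, ← Finset.prod_mul_distrib]
  refine Finset.prod_eq_one fun j hj => ?_
  have := hb.inv (Finset.ne_of_mem_erase hj) k 0
  rw [Int.cast_zero, add_zero] at this
  rw [mul_comm, this]

theorem qdet_op [IsDomain R] {b : Fin p → R} (hb : Generic b)
    (g : Fin (2 * p) → R) (u : R) :
    E11 b g u * E22 b (u - 1) 1 - E21 b g u 1 * E12 b g (u - 1) 1 =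
      diagOp fun _ => gammaVal g u := by
  have e : E11 b g u * E22 b (u - 1) 1 - E21 b g u 1 * E12 b g (u - 1) 1 =
      E22 b u 1 * E22 b (u - 1) 1 + ((E11 b g u - E22 b u 1) * E22 b (u - 1) 1 -
        E21 b g u 1 * E12 b g (u - 1) 1) := aux_add (A := LatticeEnd R p) _ _ _ _
  rw [e, E11_sub, E22, E22, E21, E12, mid_mul_diag, up_mul_down, midOp_sub, diag_mul_diag,
    midOp_diag]
  · apply end_ext; intro k
    rw [LinearMap.add_apply, diagOp_single, diagOp_single, diagOp_single, ← Finsupp.single_add,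
      one_mul, one_mul, one_mul]
    congr 1
    have hne : ∀ i j, i ≠ j → ∀ m : ℤ, wt b k i - wt b k j + m ≠ 0 := fun i j hij m h0 => by
      have := hb.inv hij k m
      rw [h0] at this; simp at this
    rw [← lagrange_id (wt b k) hne g
      (fun i => lam b k i * lam b (k - Pi.single i 1) i)
      (fun i => lam b k i * lam b (k + Pi.single i 1) i) ?_ ?_ u]
    · congr 1
      · simp [prd]
      · refine Finset.sum_congr rfl fun i _ => ?_
        rw [prd_univ b k i, prd_sub_self, hc, if_pos rfl, coeffAB, coeffBA, Finset.erase_idem]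
        have e1 : ∀ u, prd b k (Finset.univ.erase i) u 1 =
          ∏ j ∈ Finset.univ.erase i, (u + wt b k j) := fun u => by simp [prd]
        rw [e1, e1]
        linear_combination (∏ j ∈ Finset.univ.erase i, (u - 1 + wt b k j)) *
          (∏ j ∈ Finset.univ.erase i, (u + wt b k j)) * lam b k i *
          lam b (k - Pi.single i 1) i * - coeffBA b g k i
    · intro i
      have h1 := lam_cancel hb k i
      have h2 := lam_cancel hb (k - Pi.single i 1) i
      have e1 : ∏ j ∈ Finset.univ.erase i, (wt b (k - Pi.single i 1) j - wt b (k - Pi.single i 1) i) =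
          ∏ j ∈ Finset.univ.erase i, (wt b k j - wt b k i + 1) :=
        Finset.prod_congr rfl fun j hj => by
          rw [wt_sub_self, wt_sub_ne b k (Finset.ne_of_mem_erase hj)]; ring
      rw [e1] at h2
      linear_combination congrArg₂ (· * ·) h1 h2
    · intro i
      have h1 := lam_cancel hb k i
      have h2 := lam_cancel hb (k + Pi.single i 1) i
      have e1 : ∏ j ∈ Finset.univ.erase i, (wt b (k + Pi.single i 1) j - wt b (k + Pi.single i 1) i) =
          ∏ j ∈ Finset.univ.erase i, (wt b k j - wt b k i - 1) :=
        Finset.prod_congr rfl fun j hj => by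
          rw [wt_add_self, wt_add_ne b k (Finset.ne_of_mem_erase hj)]; ring
      rw [e1] at h2
      linear_combination congrArg₂ (· * ·) h1 h2
  · intro k i j hij
    have hji : j ≠ i := fun h => hij h.symm
    have hinv : Ring.inverse (wt b k i - wt b k j) = - Ring.inverse (wt b k j - wt b k i) := by
      rw [← inv_neg', neg_sub]
    rw [hc, if_neg hij, prd_univ b k j, prd_sub_ne b k hij, prd_erase b k hij, coeffA_sub b g k hij,
      lam_add b k hji, lam_sub b k hij, lam_eq b k hij, lam_eq b k hji,
      Finset.erase_right_comm (a := j) (b := i),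
      show wt b k i + 1 - wt b k j = wt b k i - wt b k j + 1 by ring,
      show wt b k j - 1 - wt b k i = -(wt b k i - wt b k j + 1) by ring, hinv, inv_neg']
    ring


theorem end_tf [IsDomain R] [CharZero R] (n : ℤ) (x : LatticeEnd R p) (hn : n ≠ 0)
    (h : n • x = 0) : x = 0 := by
  apply end_ext; intro k
  ext k'
  have h1 := DFunLike.congr_fun (LinearMap.congr_fun h (Finsupp.single k 1)) k'
  simpa [hn] using h1

theorem end_extract [IsDomain R] [CharZero R] (n : ℕ) (x : ℕ → LatticeEnd R p)
    (h : ∀ u : ℤ, ∑ a ∈ Finset.range n, (u ^ a) • x a = 0) : ∀ a < n, x a = 0 := by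
  intro a ha
  apply end_ext; intro k
  ext k'
  let P : R[X] := ∑ a ∈ Finset.range n, C (x a (Finsupp.single k 1) k') * X ^ a
  have hP : P = 0 := by
    apply Polynomial.eq_zero_of_infinite_isRoot
    refine Set.Infinite.mono ?_ (Set.infinite_range_of_injective (Int.cast_injective (α := R)))
    rintro _ ⟨u, rfl⟩
    have h1 := DFunLike.congr_fun (LinearMap.congr_fun (h u) (Finsupp.single k 1)) k'
    simp only [LinearMap.sum_apply, Finsupp.finsetSum_apply] at h1
    simp only [P, Set.mem_ofPred_eq, IsRoot, eval_finsetSum, eval_mul, eval_C, eval_pow, eval_X]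
    refine Eq.trans ?_ h1
    refine Finset.sum_congr rfl fun a _ => ?_
    simp [mul_comm]
  have h2 := congrArg (fun q => coeff q a) hP
  simpa [P, coeff_C_mul, coeff_X_pow, ha] using h2

theorem coeff_rel {A : Type*} [Ring A]
    (hex : ∀ (n : ℕ) (x : ℕ → A), (∀ u : ℤ, ∑ a ∈ Finset.range n, (u ^ a) • x a = 0) →
      ∀ a < n, x a = 0) (N : ℕ) (x y z w x' y' : ℕ → A)
    (hx' : ∀ u : ℤ, u • ∑ a ∈ Finset.range N, (u ^ a) • x a = ∑ a ∈ Finset.range N, (u ^ a) • x' a)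
    (hy' : ∀ u : ℤ, u • ∑ a ∈ Finset.range N, (u ^ a) • y a = ∑ a ∈ Finset.range N, (u ^ a) • y' a)
    (h : ∀ u v : ℤ, (u - v) • ⁅∑ a ∈ Finset.range N, (u ^ a) • x a,
        ∑ a ∈ Finset.range N, (v ^ a) • y a⁆ =
      (∑ a ∈ Finset.range N, (u ^ a) • z a) * (∑ a ∈ Finset.range N, (v ^ a) • w a) -
      (∑ a ∈ Finset.range N, (v ^ a) • z a) * (∑ a ∈ Finset.range N, (u ^ a) • w a))
    (a b : ℕ) (ha : a < N) (hb : b < N) :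
    ⁅x' a, y b⁆ - ⁅x a, y' b⁆ = z a * w b - z b * w a := by
  have hz1 : ∀ (n : ℤ) (x y : A), x * (n • y) = n • (x * y) := fun n x y => by
    simp only [zsmul_eq_mul, ← mul_assoc, (Int.cast_commute n x).eq]
  have hz2 : ∀ (n : ℤ) (x y : A), (n • x) * y = n • (x * y) := fun n x y => by
    simp only [zsmul_eq_mul, mul_assoc]
  have ev1 : ∀ (x : ℕ → A) (u : ℤ) (m : A),
      (∑ a ∈ Finset.range N, (u ^ a) • x a) * m = ∑ a ∈ Finset.range N, (u ^ a) • (x a * m) :=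
    fun x u m => by simp only [Finset.sum_mul, hz2]
  have ev2 : ∀ (x : ℕ → A) (u : ℤ) (m : A),
      m * (∑ a ∈ Finset.range N, (u ^ a) • x a) = ∑ a ∈ Finset.range N, (u ^ a) • (m * x a) :=
    fun x u m => by simp only [Finset.mul_sum, hz1]
  simp only [Ring.lie_def] at *
  have step1 : ∀ v : ℤ, ∀ a < N,
      (x' a * (∑ a ∈ Finset.range N, (v ^ a) • y a) -
        (∑ a ∈ Finset.range N, (v ^ a) • y a) * x' a) -
      (x a * (∑ a ∈ Finset.range N, (v ^ a) • y' a) -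
        (∑ a ∈ Finset.range N, (v ^ a) • y' a) * x a) -
      (z a * (∑ a ∈ Finset.range N, (v ^ a) • w a) -
        (∑ a ∈ Finset.range N, (v ^ a) • z a) * w a) = 0 := by
    intro v
    apply hex N
    intro u
    have h1 := h u v
    simp only [smul_sub, Finset.sum_sub_distrib, ← ev1, ← ev2]
    rw [← hx', ← hy', ← h1]
    simp only [hz1, hz2, sub_smul, smul_sub]
    abel
  have step2 := hex N (fun b => (x' a * y b - y b * x' a) - (x a * y' b - y' b * x a) -
      (z a * w b - z b * w a)) (by
    intro v
    have h1 := step1 v a ha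
    simp only [smul_sub, Finset.sum_sub_distrib, ← ev1, ← ev2]
    exact h1) b hb
  exact sub_eq_zero.mp step2

theorem eval_betaPoly (b : Fin p → R) (k : Fin p → ℤ) (u : R) :
    ∑ a ∈ Finset.range (p + 1), (betaPoly b k).coeff a * u ^ a = prd b k Finset.univ u 1 := by
  rw [← Polynomial.eval_eq_sum_range' (p := betaPoly b k)]
  · simp [betaPoly, prd, eval_prod]
  · refine Nat.lt_succ_of_le ((natDegree_prod_le _ _).trans ?_)
    refine (Finset.sum_le_card_nsmul _ _ 1 fun j _ => ?_).trans (by simp)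
    compute_degree

theorem lagrangePoly_eq (b : Fin p → R) (k : Fin p → ℤ) (i : Fin p) :
    lagrangePoly b k i = C (lam b k i) * ∏ j ∈ Finset.univ.erase i, (X + C (wt b k j)) := by
  rw [lagrangePoly, Finset.prod_mul_distrib, lam, map_prod]

theorem natDegree_lagr (b : Fin p → R) (k : Fin p → ℤ) (i : Fin p) :
    (∏ j ∈ Finset.univ.erase i, (X + C (wt b k j))).natDegree ≤ p - 1 := by
  refine (natDegree_prod_le _ _).trans ?_
  refine (Finset.sum_le_card_nsmul _ _ 1 fun j _ => ?_).trans (by simp)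
  compute_degree

theorem eval_lagrangePoly (b : Fin p → R) (k : Fin p → ℤ) (i : Fin p) (u : R) :
    ∑ a ∈ Finset.range (p + 1), (lagrangePoly b k i).coeff a * u ^ a =
      lam b k i * prd b k (Finset.univ.erase i) u 1 := by
  rw [← Polynomial.eval_eq_sum_range' (p := lagrangePoly b k i), lagrangePoly_eq]
  · simp [prd, eval_prod]
  · rw [lagrangePoly_eq]
    refine Nat.lt_succ_of_le ((natDegree_C_mul_le _ _).trans ?_)
    exact (natDegree_lagr b k i).trans (Nat.sub_le _ _)

theorem coeff_lagrangePoly (b : Fin p → R) (k : Fin p → ℤ) (i : Fin p) :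
    (lagrangePoly b k i).coeff (p - 1) = lam b k i := by
  rw [lagrangePoly_eq, coeff_C_mul]
  nontriviality R
  have hm : (∏ j ∈ Finset.univ.erase i, (X + C (wt b k j))).Monic :=
    monic_prod_of_monic _ _ fun j _ => monic_X_add_C _
  have hd : (∏ j ∈ Finset.univ.erase i, (X + C (wt b k j))).natDegree = p - 1 := by
    rw [natDegree_prod_of_monic _ _ (fun j _ => monic_X_add_C _)]
    simp only [natDegree_X_add_C]; simp
  have := hm.coeff_natDegree
  rw [hd] at this
  rw [this, mul_one]

theorem coeff_lagrangePoly_p (b : Fin p → R) (k : Fin p → ℤ) (i : Fin p) :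
    (lagrangePoly b k i).coeff p = 0 := by
  rw [lagrangePoly_eq, coeff_C_mul, coeff_eq_zero_of_natDegree_lt, mul_zero]
  exact (natDegree_lagr b k i).trans_lt (Nat.sub_lt i.pos one_pos)

theorem coeff_betaPoly_p (b : Fin p → R) (k : Fin p → ℤ) : (betaPoly b k).coeff p = 1 := by
  nontriviality R
  have hm : (betaPoly b k).Monic := monic_prod_of_monic _ _ fun j _ => monic_X_add_C _
  have hd : (betaPoly b k).natDegree = p := by
    rw [betaPoly, natDegree_prod_of_monic _ _ (fun j _ => monic_X_add_C _)]
    simp only [natDegree_X_add_C]; simp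
  have := hm.coeff_natDegree
  rwa [hd] at this

theorem op12_one (b : Fin p → R) (g : Fin (2 * p) → R) : op12 b g 1 = E12 b g 1 0 := by
  rw [op12, E12, downOp]
  congr 1; funext k
  refine Finset.sum_congr rfl fun i _ => ?_
  rw [coeff_lagrangePoly, prd_zero, mul_one]

theorem ev22 (b : Fin p → R) (u : ℤ) :
    ∑ a ∈ Finset.range (p + 1), (u ^ a) • op22 b (p - a) = E22 b (u : R) 1 := by
  apply end_ext; intro k
  rw [LinearMap.sum_apply, E22, diagOp_single, one_mul, ← eval_betaPoly,
    ← Finsupp.singleAddHom_apply k (∑ a ∈ Finset.range (p + 1), _), map_sum]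
  refine Finset.sum_congr rfl fun a ha => ?_
  have : p - (p - a) = a := Nat.sub_sub_self (Nat.lt_succ_iff.mp (Finset.mem_range.mp ha))
  simp [op22, this, mul_comm]

theorem ev21 (b : Fin p → R) (g : Fin (2 * p) → R) (u : ℤ) :
    ∑ a ∈ Finset.range (p + 1), (u ^ a) • op21 b g (p - a) = E21 b g (u : R) 1 := by
  apply end_ext; intro k
  rw [LinearMap.sum_apply, E21, upOp_single]
  simp only [one_mul, mul_assoc, ← eval_lagrangePoly, Finset.mul_sum]
  simp only [← Finsupp.singleAddHom_apply, map_sum]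
  rw [Finset.sum_comm]
  refine Finset.sum_congr rfl fun a ha => ?_
  have : p - (p - a) = a := Nat.sub_sub_self (Nat.lt_succ_iff.mp (Finset.mem_range.mp ha))
  simp only [op21, this, LinearMap.smul_apply, Finsupp.linearCombination_single, one_smul,
    Finset.smul_sum, Finsupp.singleAddHom_apply, Finsupp.smul_single, zsmul_eq_mul]
  refine Finset.sum_congr rfl fun i _ => ?_
  congr 1; push_cast; ring

theorem ev12 (b : Fin p → R) (g : Fin (2 * p) → R) (u : ℤ) :
    ∑ a ∈ Finset.range (p + 1), (u ^ a) • op12 b g (p - a) = E12 b g (u : R) 1 := by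
  apply end_ext; intro k
  rw [LinearMap.sum_apply, E12, downOp_single]
  simp only [one_mul, mul_assoc, ← eval_lagrangePoly, Finset.mul_sum]
  simp only [← Finsupp.singleAddHom_apply, map_sum]
  rw [Finset.sum_comm]
  refine Finset.sum_congr rfl fun a ha => ?_
  have : p - (p - a) = a := Nat.sub_sub_self (Nat.lt_succ_iff.mp (Finset.mem_range.mp ha))
  simp only [op12, this, LinearMap.smul_apply, Finsupp.linearCombination_single, one_smul,
    Finset.smul_sum, Finsupp.singleAddHom_apply, Finsupp.smul_single, zsmul_eq_mul]
  refine Finset.sum_congr rfl fun i _ => ?_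
  congr 1; push_cast; ring

theorem lie_ev {A : Type*} [Ring A] (m : A) (y : ℕ → A) (n : ℕ) (c : ℕ → ℤ) :
    ∑ a ∈ Finset.range n, c a • ⁅m, y a⁆ = ⁅m, ∑ a ∈ Finset.range n, c a • y a⁆ := by
  simp only [Ring.lie_def, Finset.mul_sum, Finset.sum_mul, ← Finset.sum_sub_distrib, smul_sub,
    zsmul_eq_mul, mul_assoc]
  refine Finset.sum_congr rfl fun a _ => ?_
  rw [← mul_assoc m, ← (Int.cast_commute (c a) m).eq, mul_assoc]

theorem ev11 (b : Fin p → R) (g : Fin (2 * p) → R) (u : ℤ) :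
    ∑ a ∈ Finset.range (p + 1), (u ^ a) • op11 b g (p - a) = E11 b g (u : R) := by
  have h1 : ∑ a ∈ Finset.range (p + 1), (u ^ a) • op11 b g (p - a) =
      E22 b (u : R) 1 + ⁅E12 b g 1 0, E21 b g (u : R) 1⁆ := by
    simp only [op11, smul_add, Finset.sum_add_distrib]
    rw [ev22, lie_ev (A := LatticeEnd R p), ev21, op12_one]
  rw [h1, lie_a_21]; abel

theorem ev_opT (b : Fin p → R) (g : Fin (2 * p) → R) (i j : Fin 2) (u : ℤ) :
    ∑ a ∈ Finset.range (p + 1), (u ^ a) • opT b g i j (p - a) =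
    (!![fun u : ℤ => E11 b g (u : R), fun u => E12 b g (u : R) 1;
        fun u => E21 b g (u : R) 1, fun u => E22 b (u : R) 1] i j) u := by
  have h : ∀ a, ¬ p < p - a := fun a => by omega
  simp only [opT, if_neg (h _)]
  fin_cases i <;> fin_cases j
  · exact ev11 b g u
  · exact ev12 b g u
  · exact ev21 b g u
  · exact ev22 b u

theorem opT_zero (b : Fin p → R) (g : Fin (2 * p) → R) (i j : Fin 2) :
    opT b g i j 0 = if i = j then 1 else 0 := by
  have h22 : op22 b 0 = 1 := by
    apply end_ext; intro k; simp [op22, coeff_betaPoly_p]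
  have h21 : op21 b g 0 = 0 := by
    apply end_ext; intro k; simp [op21, coeff_lagrangePoly_p]
  have h12 : op12 b g 0 = 0 := by
    apply end_ext; intro k; simp [op12, coeff_lagrangePoly_p]
  have h11 : op11 b g 0 = 1 := by
    rw [op11, h22, h21, Ring.lie_def]; simp
  rw [opT, if_neg (Nat.not_lt_zero _)]
  fin_cases i <;> fin_cases j <;> simp [h11, h12, h21, h22]

theorem E_rel [IsDomain R] [CharZero R] {b : Fin p → R} (hb : Generic b)
    (hb0 : ∀ (i : Fin p) (m : ℤ), b i + m ≠ 0) (g : Fin (2 * p) → R) (i j k l : Fin 2)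
    (u v : ℤ) :
    (u - v) • ⁅∑ a ∈ Finset.range (p + 1), (u ^ a) • opT b g i j (p - a),
        ∑ a ∈ Finset.range (p + 1), (v ^ a) • opT b g k l (p - a)⁆ =
      (∑ a ∈ Finset.range (p + 1), (u ^ a) • opT b g k j (p - a)) *
        (∑ a ∈ Finset.range (p + 1), (v ^ a) • opT b g i l (p - a)) -
      (∑ a ∈ Finset.range (p + 1), (v ^ a) • opT b g k j (p - a)) *
        (∑ a ∈ Finset.range (p + 1), (u ^ a) • opT b g i l (p - a)) := by
  simp only [ev_opT]
  refine rel_of_core (A := LatticeEnd R p) end_tf _ _ _ _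
    (fun u => diagOp fun _ => gammaVal g (u : R)) (E12 b g 1 0) (E21 b g 1 0) ?_
    (fun u v => comm_22 b _ _) (fun u v => comm_21 hb g _ _ _ _) (fun u v => comm_12 hb g _ _ _ _)
    (rel_21_22 b g) (rel_22_21 b g) (rel_12_22 b g) (rel_22_12 b g) (rel_12_21 b g)
    (fun v => lie_a_22 b g _) (fun v => ?_) (fun v => lie_a_21 b g _) (fun v => lie_12_e b g _)
    (fun v => lie_22_e b g _) (fun v => ?_) (fun v => ?_) (fun v => ?_) (fun v => ?_) i j k l u v
  · intro u x hx
    apply end_ext; intro k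
    have h1 := LinearMap.congr_fun hx (Finsupp.single k 1)
    rw [Module.End.mul_apply, E22, diagOp_single, one_mul, ← mul_one (prd _ _ _ _ _),
      ← smul_eq_mul, ← Finsupp.smul_single, map_smul] at h1
    refine (smul_eq_zero.mp h1).resolve_left ?_
    rw [prd, ← ne_eq, Finset.prod_ne_zero_iff]
    intro i _ h0
    apply hb0 i (u + k i)
    rw [← h0, wt]; push_cast; ring
  · rw [Ring.lie_def, comm_12 hb g, sub_self]
  · rw [Ring.lie_def, comm_21 hb g, sub_self]
  · rw [E12, diag_mul_down, down_mul_diag]; congr 1; funext k i; ring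
  · rw [E21, diag_mul_up, up_mul_diag]; congr 1; funext k i; ring
  · rw [Int.cast_sub, Int.cast_one]; exact qdet_op hb g _

theorem opT_qdet [IsDomain R] {b : Fin p → R} (hb : Generic b) (g : Fin (2 * p) → R) (u : ℤ) :
    (∑ a ∈ Finset.range (p + 1), (u ^ a) • opT b g 0 0 (p - a)) *
        (∑ a ∈ Finset.range (p + 1), ((u - 1) ^ a) • opT b g 1 1 (p - a)) -
      (∑ a ∈ Finset.range (p + 1), (u ^ a) • opT b g 1 0 (p - a)) *
        (∑ a ∈ Finset.range (p + 1), ((u - 1) ^ a) • opT b g 0 1 (p - a)) =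
      gammaVal g (u : R) • (1 : LatticeEnd R p) := by
  simp only [ev_opT]
  have h := qdet_op hb g (u : R)
  rw [← Int.cast_one, ← Int.cast_sub, Int.cast_one] at h
  refine Eq.trans h ?_
  apply end_ext; intro k
  simp [diagOp_single]

theorem opT_rel [IsDomain R] [CharZero R] {b : Fin p → R} (hb : Generic b)
    (hb0 : ∀ (i : Fin p) (m : ℤ), b i + m ≠ 0) (g : Fin (2 * p) → R) (i j k l : Fin 2)
    (r s : ℕ) :
    ⁅opT b g i j (r + 1), opT b g k l s⁆ - ⁅opT b g i j r, opT b g k l (s + 1)⁆ =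
      opT b g k j r * opT b g i l s - opT b g k j s * opT b g i l r := by
  have hbig : ∀ (i j : Fin 2) (r : ℕ), p < r → opT b g i j r = 0 := fun i j r h => if_pos h
  by_cases hr : p < r
  · simp [hbig _ _ r hr, hbig _ _ (r + 1) (by omega), Ring.lie_def]; abel
  by_cases hs : p < s
  · simp [hbig _ _ s hs, hbig _ _ (s + 1) (by omega), Ring.lie_def]; abel
  let x : Fin 2 → Fin 2 → ℕ → LatticeEnd R p :=
    fun i j a => if a ≤ p then opT b g i j (p - a) else 0
  let x' : Fin 2 → Fin 2 → ℕ → LatticeEnd R p :=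
    fun i j a => match a with
    | 0 => 0
    | a + 1 => x i j a
  have hev : ∀ i j (u : ℤ), ∑ a ∈ Finset.range (p + 2), (u ^ a) • x i j a =
      ∑ a ∈ Finset.range (p + 1), (u ^ a) • opT b g i j (p - a) := by
    intro i j u
    rw [Finset.sum_range_succ]
    have : x i j (p + 1) = 0 := if_neg (by omega)
    rw [this, smul_zero, add_zero]
    refine Finset.sum_congr rfl fun a ha => ?_
    rw [show x i j a = opT b g i j (p - a) from
      if_pos (Nat.lt_succ_iff.mp (Finset.mem_range.mp ha))]
  have hsh : ∀ i j (u : ℤ), u • ∑ a ∈ Finset.range (p + 2), (u ^ a) • x i j a =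
      ∑ a ∈ Finset.range (p + 2), (u ^ a) • x' i j a := by
    intro i j u
    rw [Finset.sum_range_succ, Finset.sum_range_succ' (fun a => (u ^ a) • x' i j a)]
    have : x i j (p + 1) = 0 := if_neg (by omega)
    rw [this, smul_zero, add_zero, Finset.smul_sum]
    simp only [x', smul_zero, add_zero, smul_smul, ← pow_succ']
  have hx : ∀ i j r, ¬ p < r → x i j (p - r) = opT b g i j r := by
    intro i j r hr
    simp only [x]
    rw [if_pos (Nat.sub_le _ _), Nat.sub_sub_self (not_lt.mp hr)]
  have hx' : ∀ i j r, ¬ p < r → x' i j (p - r) = opT b g i j (r + 1) := by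
    intro i j r hr
    by_cases h : r = p
    · subst h
      rw [hbig i j _ (Nat.lt_succ_self _), Nat.sub_self]
    · rw [show p - r = (p - (r + 1)) + 1 by omega, ← hx i j (r + 1) (by omega)]
  have key := coeff_rel (A := LatticeEnd R p) end_extract (p + 2) (x i j) (x k l) (x k j) (x i l)
    (x' i j) (x' k l) (hsh i j) (hsh k l)
    (fun u v => by rw [hev, hev, hev, hev, hev, hev]; exact E_rel hb hb0 g i j k l u v)
    (p - r) (p - s) (by omega) (by omega)
  rw [hx _ _ _ hr, hx _ _ _ hr, hx _ _ _ hr, hx _ _ _ hs, hx _ _ _ hs, hx _ _ _ hs, hx' _ _ _ hr,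
    hx' _ _ _ hs] at key
  exact key

end ops

/-! ## The ring of coefficients -/

/-- The polynomial ring in `b_1, …, b_p, g_1, …, g_{2p}`. -/
abbrev ParamRing (K : Type*) [Field K] (p : ℕ) : Type _ := MvPolynomial (Fin p ⊕ Fin (2 * p)) K

/-- The multiplicative set generated by the `b_i - b_j - m` with `i ≠ j` and `m ∈ ℤ`. -/
def genericSubmonoid (K : Type*) [Field K] (p : ℕ) : Submonoid (ParamRing K p) :=
  Submonoid.closure {f | ∃ i j : Fin p, i ≠ j ∧ ∃ m : ℤ,
    f = MvPolynomial.X (Sum.inl i) - MvPolynomial.X (Sum.inl j) - MvPolynomial.C (m : K)}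

/-- The localization of the polynomial ring at this multiplicative set. -/
def GenericRing (K : Type*) [Field K] (p : ℕ) : Type _ := Localization (genericSubmonoid K p)

instance (K : Type*) [Field K] (p : ℕ) : CommRing (GenericRing K p) :=
  inferInstanceAs (CommRing (Localization (genericSubmonoid K p)))

instance (K : Type*) [Field K] (p : ℕ) : Algebra (ParamRing K p) (GenericRing K p) :=
  inferInstanceAs (Algebra (ParamRing K p) (Localization (genericSubmonoid K p)))

instance (K : Type*) [Field K] (p : ℕ) : IsLocalization (genericSubmonoid K p) (GenericRing K p) :=
  inferInstanceAs (IsLocalization (genericSubmonoid K p) (Localization (genericSubmonoid K p)))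

instance (K : Type*) [Field K] (p : ℕ) : Algebra K (GenericRing K p) :=
  ((algebraMap (ParamRing K p) (GenericRing K p)).comp MvPolynomial.C).toAlgebra

instance (K : Type*) [Field K] (p : ℕ) :
    IsScalarTower K (ParamRing K p) (GenericRing K p) :=
  IsScalarTower.of_algebraMap_eq fun _ => rfl

/-- The variable `b_i` in the localization. -/
def varB (K : Type*) [Field K] (p : ℕ) (i : Fin p) : GenericRing K p :=
  algebraMap (ParamRing K p) (GenericRing K p) (MvPolynomial.X (Sum.inl i))

/-- The variable `g_j` in the localization. -/
def varG (K : Type*) [Field K] (p : ℕ) (j : Fin (2 * p)) : GenericRing K p :=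
  algebraMap (ParamRing K p) (GenericRing K p) (MvPolynomial.X (Sum.inr j))

theorem genericSubmonoid_le (K : Type*) [Field K] (p : ℕ) :
    genericSubmonoid K p ≤ nonZeroDivisors (ParamRing K p) := by
  refine Submonoid.closure_le.mpr ?_
  rintro _ ⟨i, j, hij, m, rfl⟩
  rw [SetLike.mem_coe, mem_nonZeroDivisors_iff_ne_zero]
  intro h
  have := congrArg (MvPolynomial.eval
    (fun x => if x = Sum.inl i then (m : K) + 1 else 0)) h
  have hji : j ≠ i := fun h => hij h.symm
  simp [hji] at this

instance (K : Type*) [Field K] (p : ℕ) : IsDomain (GenericRing K p) :=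
  IsLocalization.isDomain_localization (genericSubmonoid_le K p)

theorem algebraMap_inj (K : Type*) [Field K] (p : ℕ) :
    Function.Injective (algebraMap (ParamRing K p) (GenericRing K p)) :=
  IsLocalization.injective _ (genericSubmonoid_le K p)

instance (K : Type*) [Field K] [CharZero K] (p : ℕ) : CharZero (GenericRing K p) :=
  charZero_of_injective_algebraMap (algebraMap_inj K p)

theorem varB_generic (K : Type*) [Field K] (p : ℕ) : Generic (varB K p) := by
  intro i j hij m
  have h := IsLocalization.map_units (GenericRing K p) (⟨_, Submonoid.subset_closure
    ⟨i, j, hij, -m, rfl⟩⟩ : genericSubmonoid K p)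
  simpa [varB] using h

theorem varB_ne (K : Type*) [Field K] (p : ℕ) (i : Fin p) (m : ℤ) : varB K p i + m ≠ 0 := by
  intro h
  have h1 : algebraMap (ParamRing K p) (GenericRing K p)
    (MvPolynomial.X (Sum.inl i) + MvPolynomial.C (m : K)) = 0 := by
    rw [← h]; simp [varB]
  rw [map_eq_zero_iff _ (algebraMap_inj K p)] at h1
  have := congrArg (MvPolynomial.eval (fun _ => (1 : K) - m)) h1
  simp at this

/-! ## The universal representation -/

theorem lift_freeGen (K : Type*) [Field K] [CharZero K] (p : ℕ) (i j : Fin 2) (r : ℕ) :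
    FreeAlgebra.lift K (fun x : Fin 2 × Fin 2 × Fin p =>
      opT (varB K p) (varG K p) x.1 x.2.1 (x.2.2 + 1)) (freeGen K p i j r) =
    opT (varB K p) (varG K p) i j r := by
  cases r with
  | zero => rw [opT_zero, freeGen]; split_ifs <;> simp
  | succ r =>
    rw [freeGen]
    split_ifs with h
    · simp
    · rw [map_zero, opT, if_pos (by omega)]

/-- The universal representation `G`: the homomorphism that sends each generator `t_{ij}^{(r)}` to its
matrix. -/
def universalRep (K : Type*) [Field K] [CharZero K] (p : ℕ) :
    Yangian K p →ₐ[K] LatticeEnd (GenericRing K p) p :=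
  RingQuot.liftAlgHom K ⟨FreeAlgebra.lift K fun x : Fin 2 × Fin 2 × Fin p =>
    opT (varB K p) (varG K p) x.1 x.2.1 (x.2.2 + 1), by
      rintro _ _ ⟨i, j, k, l, r, s⟩
      have := opT_rel (varB_generic K p) (varB_ne K p) (varG K p) i j k l r s
      have hφ := lift_freeGen K p
      generalize FreeAlgebra.lift K (fun x : Fin 2 × Fin 2 × Fin p =>
        opT (varB K p) (varG K p) x.1 x.2.1 (x.2.2 + 1)) = φ at hφ ⊢
      simp only [← hφ] at this
      have hsub : ∀ a b : FreeAlgebra K (Fin 2 × Fin 2 × Fin p), φ (a - b) = φ a - φ b := fun a b =>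
        eq_sub_of_add_eq ((map_add φ (a - b) b).symm.trans (congrArg φ (sub_add_cancel a b)))
      simp only [Ring.lie_def] at this ⊢
      rw [hsub, hsub, hsub, hsub]
      simp only [map_mul]
      exact this⟩

theorem universalRep_t (K : Type*) [Field K] [CharZero K] (p : ℕ) (i j : Fin 2) (r : ℕ) :
    universalRep K p (t K p i j r) = opT (varB K p) (varG K p) i j r := by
  rw [t, universalRep, RingQuot.liftAlgHom_mkAlgHom_apply, lift_freeGen]

/-- `G(x)` as a matrix: the entry at `(k', k)` is the coefficient of `ξ^(k')` in `x ξ^(k)`. -/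
def universalMatrix (K : Type*) [Field K] [CharZero K] (p : ℕ) (x : Yangian K p) :
    Matrix (Fin p → ℤ) (Fin p → ℤ) (GenericRing K p) :=
  fun k' k => universalRep K p x (Finsupp.single k 1) k'

end LevelYangian

end

/-! The proof compares `Γ` with the whole Yangian through a Whittaker functional, a linear map `ψ`
from the lattice module to power series in `ε_0, …, ε_{p-1}` on which `T_{21}(u)` acts by the scalar
polynomial `χ(u) = 1 + ∑ ε_n u^n`. Writing `W(k) = ψ(ξ^(k))`, this requires `W(k+δ_i) A_i(k) =
χ(-b_i-k_i) W(k)`, after which Lagrange interpolation at the `p` nodes `-b_i-k_i` gives back `χ`.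
The recursion is solvable because `A_i(k) = 1` for `k_i ≥ 0` and because `χ(-b_i-k_i)` is a unit,
its constant term being `1`. Hence `t_{21}^{(p-n)} - δ_{n0}` acts under `ψ` as multiplication by
`ε_n` (`whittaker_op21`).

Give `t_{ij}^{(r)}` the degree `r` and also the shifted degree `r + p(j-i)`. Commutators lower both
by one, so words can be sorted, with the shifted lower generators `t_{21}^{(p-n)} - δ_{n0}` on the
left (`filt_le_span`). Sorting terminates by the first degree. The second degree is nonpositive on
the lower generators. On the other generators it takes the values `1, …, p` and `1, …, 2p`, exactly
the degrees of the `t_{22}^{(r)}` and of the coefficients of the quantum determinant.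

Let the row `α` of `x` be the coefficient of `ε^α` in `ψ(x ξ^(k))`, as a function of `k`. The row
`0` kills every sorted word with a lower factor, so on elements of shifted degree at most `f` it
lies in the span of the rows of upper monomials of weight at most `f`. Monomials in the generators
of `Γ` are among these elements, and their rows are linearly independent: at `k = 0` they are
monomials in elementary symmetric polynomials of the `b_i` and of the `g_j`. Both families have the
same finite number of members up to each weight, so a dimension count shows that the rows of the
upper monomials are independent too, and that the two families span the same space
(`whittakerRow_upperMon`).

Everything follows from this count. If `G(x) = 0`, expand `x` in sorted words and take a minimal
lower exponent `α`; the row `α` of `x` is a combination of independent rows with the coefficients at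
`α`, which therefore vanish (`universalRep_injective`). If `G(x)` is diagonal, choose `z ∈ Γ` with
the same row `0`; then `G(x - z)` is diagonal, and its entries times the nonzero constant terms of
`W(k)` vanish, so `x = z` (`mem_Gamma_of_diag`). Finally `Γ` is commutative since its matrices are
diagonal and `G` is faithful, and it is maximal since an element commuting with all `t_{22}^{(r)}`,
whose joint eigenvalues separate lattice points, has a diagonal matrix. -/

noncomputable section

namespace LevelYangian

/-! ## Words in the generators and the two filtrations of the Yangian -/

section filtration
variable (K : Type*) [Field K] (p : ℕ)

/-- Algebra generators of the Yangian: the elements `t_{21}^{(p-n)} - δ_{n0}`, the elements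
`t_{22}^{(r)}`, and the elements `t_{11}^{(r)}` followed by the `t_{12}^{(r)}`. -/
def gen : Fin p ⊕ (Fin p ⊕ Fin (2 * p)) → Yangian K p
  | Sum.inl n => t K p 1 0 (p - n) - algebraMap K _ (if (n : ℕ) = 0 then 1 else 0)
  | Sum.inr (Sum.inl r) => t K p 1 1 (r + 1)
  | Sum.inr (Sum.inr s) => if (s : ℕ) < p then t K p 0 0 (s + 1) else t K p 0 1 (s - p + 1)

variable {p} in
/-- The standard degree, in which `t_{ij}^{(r)}` has degree `r`. -/
def stdDeg : Fin p ⊕ (Fin p ⊕ Fin (2 * p)) → ℤ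
  | Sum.inl n => p - (n : ℕ)
  | Sum.inr (Sum.inl r) => (r : ℕ) + 1
  | Sum.inr (Sum.inr s) => if (s : ℕ) < p then (s : ℕ) + 1 else (s : ℕ) - p + 1

variable {p} in
/-- The common degrees of `t_{22}^{(r)}` and of the coefficients of the quantum determinant. -/
def cartanDeg : Fin p ⊕ Fin (2 * p) → ℕ
  | Sum.inl r => r + 1
  | Sum.inr s => s + 1

variable {p} in
/-- The shifted degree, in which `t_{ij}^{(r)}` has degree `r + p (j - i)`. -/
def shiftDeg : Fin p ⊕ (Fin p ⊕ Fin (2 * p)) → ℤ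
  | Sum.inl n => -(n : ℕ)
  | Sum.inr z => cartanDeg z

/-- The span of the words of standard degree at most `e` and shifted degree at most `f`. -/
def filt (e f : ℤ) : Submodule K (Yangian K p) :=
  Submodule.span K {x | ∃ l : List (Fin p ⊕ (Fin p ⊕ Fin (2 * p))),
    (l.map stdDeg).sum ≤ e ∧ (l.map shiftDeg).sum ≤ f ∧ (l.map (gen K p)).prod = x}

variable {K p}

theorem word_mem_filt (l : List (Fin p ⊕ (Fin p ⊕ Fin (2 * p)))) :
    (l.map (gen K p)).prod ∈ filt K p (l.map stdDeg).sum (l.map shiftDeg).sum :=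
  Submodule.subset_span ⟨l, le_rfl, le_rfl, rfl⟩

theorem filt_mono {e f e' f' : ℤ} (he : e ≤ e') (hf : f ≤ f') : filt K p e f ≤ filt K p e' f' :=
  Submodule.span_mono fun _ ⟨l, h1, h2, h3⟩ => ⟨l, h1.trans he, h2.trans hf, h3⟩

theorem mem_filt_of_le {x : Yangian K p} {e f e' f' : ℤ} (h : x ∈ filt K p e f) (he : e ≤ e')
    (hf : f ≤ f') : x ∈ filt K p e' f' := filt_mono he hf h

theorem mul_mem_filt {x y : Yangian K p} {e f e' f' : ℤ} (hx : x ∈ filt K p e f)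
    (hy : y ∈ filt K p e' f') : x * y ∈ filt K p (e + e') (f + f') := by
  have h : filt K p e f * filt K p e' f' ≤ filt K p (e + e') (f + f') := by
    rw [filt, filt, Submodule.span_mul_span]
    refine Submodule.span_le.mpr ?_
    rintro _ ⟨_, ⟨l, h1, h2, rfl⟩, _, ⟨l', h1', h2', rfl⟩, rfl⟩
    exact Submodule.subset_span ⟨l ++ l', by simpa using add_le_add h1 h1',
      by simpa using add_le_add h2 h2', by simp⟩
  exact h (Submodule.mul_mem_mul hx hy)

theorem algebraMap_mem_filt (c : K) {e f : ℤ} (he : 0 ≤ e) (hf : 0 ≤ f) :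
    algebraMap K (Yangian K p) c ∈ filt K p e f := by
  rw [Algebra.algebraMap_eq_smul_one]
  exact Submodule.smul_mem _ _ (Submodule.subset_span ⟨[], by simpa, by simpa, by simp⟩)

theorem gen_mem_filt (x : Fin p ⊕ (Fin p ⊕ Fin (2 * p))) :
    gen K p x ∈ filt K p (stdDeg x) (shiftDeg x) := by
  simpa using word_mem_filt (K := K) [x]

theorem t_zero (i j : Fin 2) :
    t K p i j 0 = algebraMap K (Yangian K p) (if i = j then 1 else 0) := by
  rw [t, freeGen]; split_ifs <;> simp

theorem t_of_lt (i j : Fin 2) {r : ℕ} (h : p < r) : t K p i j r = 0 := by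
  cases r with
  | zero => omega
  | succ r => rw [t, freeGen, dif_neg (by omega), map_zero]

theorem t_mem_filt (i j : Fin 2) (r : ℕ) :
    t K p i j r ∈ filt K p r (r + p * ((j : ℕ) - (i : ℕ))) := by
  rcases Nat.eq_zero_or_pos r with rfl | hr
  · rw [t_zero]
    split_ifs with h
    · subst h; exact algebraMap_mem_filt _ (by simp) (by simp)
    · rw [map_zero]; exact Submodule.zero_mem _
  rcases lt_or_ge p r with hp | hp
  · rw [t_of_lt i j hp]; exact Submodule.zero_mem _
  have key : ∀ x : Fin p ⊕ (Fin p ⊕ Fin (2 * p)), ∀ y e f, gen K p x = y → stdDeg x = e →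
      shiftDeg x = f → y ∈ filt K p e f := by
    rintro x _ _ _ rfl rfl rfl; exact gen_mem_filt x
  fin_cases i <;> fin_cases j
  · refine key (Sum.inr (Sum.inr ⟨r - 1, by omega⟩)) _ _ _ ?_ ?_ ?_
    · simp only [gen]; rw [if_pos (by omega), Nat.sub_add_cancel hr]; rfl
    · simp only [stdDeg]; rw [if_pos (by omega)]; push_cast [hr]; ring
    · simp only [shiftDeg, cartanDeg]; push_cast [hr]; simp
  · refine key (Sum.inr (Sum.inr ⟨p + r - 1, by omega⟩)) _ _ _ ?_ ?_ ?_
    · simp only [gen]; rw [if_neg (by omega), show p + r - 1 - p + 1 = r by omega]; rfl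
    · simp only [stdDeg]; rw [if_neg (by omega)]; omega
    · simp only [shiftDeg, cartanDeg]; simp; omega
  · have h1 : t K p 1 0 r = gen K p (Sum.inl ⟨p - r, by omega⟩) +
        algebraMap K _ (if p - r = 0 then 1 else 0) := by
      simp only [gen]; rw [Nat.sub_sub_self hp]; abel
    change t K p 1 0 r ∈ _
    rw [h1]
    refine Submodule.add_mem _ (key (Sum.inl ⟨p - r, by omega⟩) _ _ _ rfl ?_ ?_) ?_
    · simp only [stdDeg]; omega
    · simp only [shiftDeg]; simp; omega
    -- The constant is present only for `r = p`, where the shifted degree of `t_{21}^{(r)}` is `0`,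
    -- so a scalar is allowed there.
    · split_ifs with h
      · exact algebraMap_mem_filt _ (by omega) (by simp; omega)
      · rw [map_zero]; exact Submodule.zero_mem _
  · refine key (Sum.inr (Sum.inl ⟨r - 1, by omega⟩)) _ _ _ ?_ ?_ ?_
    · simp only [gen]; rw [Nat.sub_add_cancel hr]; rfl
    · simp only [stdDeg]; omega
    · simp only [shiftDeg, cartanDeg]; simp; omega

/-- The defining relation trades `[t^{(r+1)}, t^{(s)}]` for `[t^{(r)}, t^{(s+1)}]` plus products of
total degree `r + s`, one less than expected. Repeating this moves the first superscript down to
`0`, where the generator is a scalar. The index exchange in the products preserves the sum of the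
two shifts `p(j-i)` and `p(l-k)`, so the shifted degree drops by one as well. -/
theorem lie_t_mem_filt (i j k l : Fin 2) (r s : ℕ) : ⁅t K p i j r, t K p k l s⁆ ∈
    filt K p (r + s - 1)
      (r + s - 1 + p * (((j : ℕ) - (i : ℕ) : ℤ) + ((l : ℕ) - (k : ℕ) : ℤ))) := by
  induction r generalizing s with
  | zero =>
    rw [t_zero, Ring.lie_def, Algebra.commutes, sub_self]
    exact Submodule.zero_mem _
  | succ r ih =>
    have h := t_rel K p i j k l r s
    rw [sub_eq_iff_eq_add] at h
    rw [h]
    have h1 : t K p k j r * t K p i l s ∈ filt K p (r + s) (r + s +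
        p * (((j : ℕ) - (i : ℕ) : ℤ) + ((l : ℕ) - (k : ℕ) : ℤ))) :=
      mem_filt_of_le (mul_mem_filt (t_mem_filt k j r) (t_mem_filt i l s)) le_rfl
        (le_of_eq (by ring))
    have h2 : t K p k j s * t K p i l r ∈ filt K p (r + s) (r + s +
        p * (((j : ℕ) - (i : ℕ) : ℤ) + ((l : ℕ) - (k : ℕ) : ℤ))) :=
      mem_filt_of_le (mul_mem_filt (t_mem_filt k j s) (t_mem_filt i l r)) (le_of_eq (by ring))
        (le_of_eq (by ring))
    have h3 := ih (s + 1)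
    refine Submodule.add_mem _ (Submodule.sub_mem _ ?_ ?_) ?_
    · exact mem_filt_of_le h1 (by push_cast; linarith) (by push_cast; linarith)
    · exact mem_filt_of_le h2 (by push_cast; linarith) (by push_cast; linarith)
    · exact mem_filt_of_le h3 (by push_cast; linarith) (by push_cast; linarith)

theorem gen_eq_t_sub (x : Fin p ⊕ (Fin p ⊕ Fin (2 * p))) : ∃ (i j : Fin 2) (r : ℕ) (c : K),
    gen K p x = t K p i j r - algebraMap K _ c ∧ stdDeg x = r ∧
      shiftDeg x = r + p * ((j : ℕ) - (i : ℕ)) := by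
  rcases x with n | r | s
  · exact ⟨1, 0, p - n, _, rfl, by simp [stdDeg, n.2.le], by simp [shiftDeg, n.2.le]; ring⟩
  · exact ⟨1, 1, r + 1, 0, by simp [gen], by simp [stdDeg], by simp [shiftDeg, cartanDeg]⟩
  · by_cases h : (s : ℕ) < p
    · exact ⟨0, 0, s + 1, 0, by simp [gen, h], by simp [stdDeg, h], by simp [shiftDeg, cartanDeg]⟩
    · refine ⟨0, 1, s - p + 1, 0, by simp [gen, h], ?_, ?_⟩
      · simp only [stdDeg]; rw [if_neg h]; omega
      · simp [shiftDeg, cartanDeg]; omega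

theorem lie_gen_mem_filt (x y : Fin p ⊕ (Fin p ⊕ Fin (2 * p))) :
    gen K p x * gen K p y - gen K p y * gen K p x ∈
      filt K p (stdDeg x + stdDeg y - 1) (shiftDeg x + shiftDeg y - 1) := by
  obtain ⟨i, j, r, c, hx, h1, h2⟩ := gen_eq_t_sub (K := K) x
  obtain ⟨k, l, s, d, hy, h3, h4⟩ := gen_eq_t_sub (K := K) y
  have h5 := lie_t_mem_filt (K := K) (p := p) i j k l r s
  have h6 : gen K p x * gen K p y - gen K p y * gen K p x = ⁅t K p i j r, t K p k l s⁆ := by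
    have e1 := Algebra.commutes c (t K p k l s)
    have e2 := Algebra.commutes d (t K p i j r)
    have e3 := Algebra.commutes d (algebraMap K (Yangian K p) c)
    rw [hx, hy, Ring.lie_def]
    simp only [sub_mul, mul_sub]
    rw [e1, e2, e3]; abel
  rw [h6]
  exact mem_filt_of_le h5 (by rw [h1, h3]) (by rw [h2, h4]; linarith)

/-- Each exchange of neighbours costs a commutator, which is one lower in both degrees. The
associated graded algebra is therefore commutative for the two degrees simultaneously. -/
theorem perm_sub_mem_filt {l l' : List (Fin p ⊕ (Fin p ⊕ Fin (2 * p)))} (h : l.Perm l') :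
    (l.map (gen K p)).prod - (l'.map (gen K p)).prod ∈
      filt K p ((l.map stdDeg).sum - 1) ((l.map shiftDeg).sum - 1) := by
  induction h with
  | nil => simp
  | cons x _ ih =>
    have := mul_mem_filt (gen_mem_filt (K := K) x) ih
    simp only [List.map_cons, List.prod_cons, List.sum_cons, ← mul_sub]
    exact mem_filt_of_le this (by linarith) (by linarith)
  | swap x y l =>
    have := mul_mem_filt (lie_gen_mem_filt (K := K) y x) (word_mem_filt (K := K) l)
    simp only [List.map_cons, List.prod_cons, List.sum_cons]
    rw [← mul_assoc, ← mul_assoc, ← sub_mul]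
    exact mem_filt_of_le this (by linarith) (by linarith)
  | trans h1 h2 ih1 ih2 =>
    rw [← (h1.map stdDeg).sum_eq, ← (h1.map shiftDeg).sum_eq] at ih2
    have h := Submodule.add_mem _ ih1 ih2
    rwa [sub_add_sub_cancel] at h

/-! ### Sorted words span the Yangian -/

/-- The word in `t_{21}^{(p-n)} - δ_{n0}` with multiplicities `α`. -/
def lowerMon (K : Type*) [Field K] {p : ℕ} (α : Fin p →₀ ℕ) : Yangian K p :=
  ((Finsupp.toMultiset α).toList.map fun n => gen K p (Sum.inl n)).prod

/-- The word in the other generators with multiplicities `m`. -/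
def upperMon (K : Type*) [Field K] {p : ℕ} (m : Fin p ⊕ Fin (2 * p) →₀ ℕ) : Yangian K p :=
  ((Finsupp.toMultiset m).toList.map fun z => gen K p (Sum.inr z)).prod

theorem exists_perm_sum {A B : Type*} [DecidableEq A] [DecidableEq B] (l : List (A ⊕ B)) :
    ∃ (α : A →₀ ℕ) (m : B →₀ ℕ), l.Perm ((Finsupp.toMultiset α).toList.map Sum.inl ++
      (Finsupp.toMultiset m).toList.map Sum.inr) := by
  suffices h : ∃ (la : List A) (lb : List B), l.Perm (la.map Sum.inl ++ lb.map Sum.inr) by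
    obtain ⟨la, lb, h⟩ := h
    refine ⟨Multiset.toFinsupp (la : Multiset A), Multiset.toFinsupp (lb : Multiset B), ?_⟩
    refine h.trans (List.Perm.append (List.Perm.map _ ?_) (List.Perm.map _ ?_)) <;>
    · rw [← Multiset.coe_eq_coe]; simp
  induction l with
  | nil => exact ⟨[], [], by simp⟩
  | cons x l ih =>
    obtain ⟨la, lb, h⟩ := ih
    rcases x with a | b
    · exact ⟨a :: la, lb, by simpa using h⟩
    · exact ⟨la, b :: lb, (h.cons _).trans (by simpa using List.perm_middle.symm)⟩

theorem filt_eq_bot {e : ℤ} (he : e < 0) (f : ℤ) : filt K p e f = ⊥ := by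
  rw [filt, Submodule.span_eq_bot]
  rintro _ ⟨l, h, -⟩
  have : 0 ≤ (l.map (stdDeg (p := p))).sum := by
    refine List.sum_nonneg ?_
    intro y hy
    obtain ⟨x, -, rfl⟩ := List.mem_map.mp hy
    -- Only the clause on degrees is needed; it does not involve the field, so any field will do.
    obtain ⟨_, _, r, _, _, h, _⟩ := gen_eq_t_sub (K := ℚ) x
    rw [h]; exact Int.natCast_nonneg r
  omega

theorem sum_map_toList_toMultiset {A M : Type*} [AddCommMonoid M] (m : A →₀ ℕ) (f : A → M) :
    ((Finsupp.toMultiset m).toList.map f).sum = m.sum fun a n => n • f a := by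
  rw [← Multiset.sum_coe, ← Multiset.map_coe, Multiset.coe_toList, Finsupp.toMultiset_map,
    Finsupp.sum_toMultiset, Finsupp.sum_mapDomain_index (by simp) (by simp [add_smul])]

theorem sum_shiftDeg_inr (m : Fin p ⊕ Fin (2 * p) →₀ ℕ) :
    ((Finsupp.toMultiset m).toList.map fun z => shiftDeg (Sum.inr z)).sum =
      (Finsupp.weight cartanDeg m : ℕ) := by
  rw [sum_map_toList_toMultiset, Finsupp.weight_apply]
  simp [Finsupp.sum, shiftDeg]

/-- Sorting a word leaves an error of smaller standard degree, and this degree is nonnegative, so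
induction on `e` ends. The shifted degree cannot drive the induction, because lower generators may
make it negative. For the same reason it bounds the weight of the upper part only when there are no
lower factors, which is the one case that the row `0` sees. -/
theorem filt_le_span (e f : ℤ) : filt K p e f ≤ Submodule.span K
    {x | ∃ (α : Fin p →₀ ℕ) (m : Fin p ⊕ Fin (2 * p) →₀ ℕ),
      (α = 0 → (Finsupp.weight cartanDeg m : ℕ) ≤ f) ∧ lowerMon K α * upperMon K m = x} := by
  suffices h : ∀ (n : ℕ) (e f : ℤ), e < n → filt K p e f ≤ Submodule.span K
    {x | ∃ (α : Fin p →₀ ℕ) (m : Fin p ⊕ Fin (2 * p) →₀ ℕ),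
      (α = 0 → (Finsupp.weight cartanDeg m : ℕ) ≤ f) ∧ lowerMon K α * upperMon K m = x} from
    h (e.toNat + 1) e f (by omega)
  intro n
  induction n with
  | zero => intro e f he; rw [filt_eq_bot (by simpa using he)]; exact bot_le
  | succ n ih =>
    intro e f he
    refine Submodule.span_le.mpr ?_
    rintro _ ⟨l, h1, h2, rfl⟩
    obtain ⟨α, m, hperm⟩ := exists_perm_sum l
    have h3 := perm_sub_mem_filt (K := K) hperm
    have h4 := ih (e - 1) f (by push_cast at he; omega)
      (mem_filt_of_le h3 (by omega) (by omega))
    rw [SetLike.mem_coe, ← sub_add_cancel (l.map (gen K p)).prod (_)]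
    refine Submodule.add_mem _ h4 (Submodule.subset_span ⟨α, m, ?_, ?_⟩)
    · rintro rfl
      rw [← sum_shiftDeg_inr]
      rw [(hperm.map shiftDeg).sum_eq] at h2
      simpa [Function.comp_def] using h2
    · simp [lowerMon, upperMon, Function.comp_def]

theorem exists_mem_filt (x : Yangian K p) : ∃ n : ℕ, x ∈ filt K p n n := by
  obtain ⟨a, rfl⟩ := RingQuot.mkAlgHom_surjective K (Rel K p) x
  induction a using FreeAlgebra.induction with
  | grade0 c =>
    exact ⟨0, by rw [AlgHom.commutes]; exact algebraMap_mem_filt _ le_rfl le_rfl⟩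
  | grade1 x =>
    have h : RingQuot.mkAlgHom K (Rel K p) (FreeAlgebra.ι K x) = t K p x.1 x.2.1 (x.2.2 + 1) := by
      rw [t, freeGen, dif_pos x.2.2.2]
    rw [h]
    -- The extra `p` absorbs the shift of `t_{12}^{(r)}`, the largest one.
    refine ⟨x.2.2 + 1 + p, mem_filt_of_le (t_mem_filt _ _ _) (by push_cast; omega) ?_⟩
    have : ((x.2.1 : ℕ) - (x.1 : ℕ) : ℤ) ≤ 1 := by omega
    push_cast
    nlinarith
  | mul a b ha hb =>
    obtain ⟨n, hn⟩ := ha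
    obtain ⟨m, hm⟩ := hb
    exact ⟨n + m, by rw [map_mul]; push_cast; exact mul_mem_filt hn hm⟩
  | add a b ha hb =>
    obtain ⟨n, hn⟩ := ha
    obtain ⟨m, hm⟩ := hb
    refine ⟨n + m, ?_⟩
    rw [map_add]
    exact Submodule.add_mem _ (mem_filt_of_le hn (by simp) (by simp))
      (mem_filt_of_le hm (by simp) (by simp))

end filtration

/-! ## Whittaker functionals -/

section whittaker

/-- The solution of `a (m + 1) * A m = C m * a m`, `a 0 = 1`, provided that `A m = 1` for `0 ≤ m`
and the `C m` are units. -/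
def whittakerCoeff {S : Type*} [CommRing S] (A C : ℤ → S) : ℤ → S
  | Int.ofNat n => ∏ j ∈ Finset.range n, C j
  | Int.negSucc n => ∏ j ∈ Finset.range (n + 1), (A (-(j + 1)) * Ring.inverse (C (-(j + 1))))

/-- Going up from `0` one divides by `A m = 1`, and going down one divides by the unit `C m`. Thus
the values `A m` with `m < 0`, here `-γ` at a point, never need to be inverted. -/
theorem whittakerCoeff_add_one {S : Type*} [CommRing S] {A C : ℤ → S} (hA : ∀ m, 0 ≤ m → A m = 1)
    (hC : ∀ m, IsUnit (C m)) (m : ℤ) :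
    whittakerCoeff A C (m + 1) * A m = C m * whittakerCoeff A C m := by
  -- The cases are `m ≥ 0`, then `m = -1`, where the two defining formulas meet, and `m ≤ -2`.
  rcases m with n | n | n
  · change whittakerCoeff A C (Int.ofNat (n + 1)) * _ = _
    simp only [whittakerCoeff]
    rw [Finset.prod_range_succ, hA _ (by simp)]
    simp [mul_comm]
  · change whittakerCoeff A C (Int.ofNat 0) * A (-1) = C (-1) * whittakerCoeff A C (Int.negSucc 0)
    have := Ring.mul_inverse_cancel _ (hC (-1))
    simp only [whittakerCoeff, Finset.range_zero, Finset.prod_empty, zero_add, Finset.range_one,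
      Finset.prod_singleton, Nat.cast_zero]
    linear_combination -A (-1) * this
  · have e : Int.negSucc (n + 1) + 1 = Int.negSucc n := rfl
    have e2 : Int.negSucc (n + 1) = -(((n + 1 : ℕ) : ℤ) + 1) := by
      rw [Int.negSucc_eq]
    have := Ring.mul_inverse_cancel _ (hC (-(((n + 1 : ℕ) : ℤ) + 1)))
    rw [e]
    simp only [whittakerCoeff]
    rw [Finset.prod_range_succ _ (n + 1), e2]
    linear_combination -(∏ j ∈ Finset.range (n + 1), (A (-(j + 1)) * Ring.inverse (C (-(j + 1))))) *
      A (-(((n + 1 : ℕ) : ℤ) + 1)) * this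

/-- Applied with `f` the constant coefficient of a power series: all the `C m` become `1`, and only
a product of nonzero elements of a domain remains. -/
theorem map_whittakerCoeff {S S' : Type*} [CommRing S] [CommRing S'] (f : S →+* S') {A C : ℤ → S}
    (hC : ∀ m, f (C m) = 1) (hu : ∀ m, IsUnit (C m)) (hA : ∀ m, f (A m) ≠ 0) [IsDomain S']
    (m : ℤ) : f (whittakerCoeff A C m) ≠ 0 := by
  have hinv : ∀ m, f (Ring.inverse (C m)) = 1 := by
    intro m
    have := congrArg f (Ring.mul_inverse_cancel _ (hu m))
    rwa [map_mul, hC, one_mul, map_one] at this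
  rcases m with n | n
  · simp [whittakerCoeff, hC]
  · simp only [whittakerCoeff, map_prod, map_mul, hinv, mul_one]
    exact Finset.prod_ne_zero_iff.mpr fun _ _ => hA _

/-! ### Lagrange interpolation and the functional on the lattice module -/

variable {R : Type*} [CommRing R] {p : ℕ}

theorem eval_lagrangePoly_self {b : Fin p → R} (hb : Generic b) (k : Fin p → ℤ) (i : Fin p) :
    (lagrangePoly b k i).eval (-wt b k i) = 1 := by
  rw [lagrangePoly_eq, eval_mul, eval_C, eval_prod, ← lam_cancel hb k i]
  congr 1
  refine Finset.prod_congr rfl fun j _ => ?_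
  simp; ring

theorem eval_lagrangePoly_ne (b : Fin p → R) (k : Fin p → ℤ) {i j : Fin p} (h : j ≠ i) :
    (lagrangePoly b k i).eval (-wt b k j) = 0 := by
  rw [lagrangePoly_eq, eval_mul, eval_prod,
    Finset.prod_eq_zero (i := j) (by simp [h]) (by simp), mul_zero]

/-- Both sides have degree less than `p` and agree at the `p` distinct nodes `-b_i-k_i`, where
`lagrangePoly b k i` takes the values `1` and `0`. -/
theorem sum_lagrangePoly [IsDomain R] {b : Fin p → R} (hb : Generic b) (k : Fin p → ℤ) {n : ℕ}
    (hn : n < p) : ∑ i, C ((-wt b k i) ^ n) * lagrangePoly b k i = X ^ n := by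
  refine Polynomial.eq_of_degrees_lt_of_eval_index_eq (v := fun i => -wt b k i) Finset.univ
    ?_ ?_ ?_ ?_
  · intro i _ j _ hij
    by_contra hne
    have := hb.inv hne k 0
    simp only [neg_inj] at hij
    simp [hij] at this
  · refine (degree_sum_le _ _).trans_lt ((Finset.sup_lt_iff (WithBot.bot_lt_coe _)).mpr ?_)
    intro i _
    refine degree_le_natDegree.trans_lt (Nat.cast_lt.mpr ?_)
    rw [lagrangePoly_eq, ← mul_assoc, ← C_mul]
    refine (natDegree_C_mul_le _ _).trans_lt ((natDegree_lagr b k i).trans_lt ?_)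
    simp; omega
  · rw [degree_X_pow]; simpa using hn
  · intro j _
    rw [eval_finsetSum, Finset.sum_eq_single j]
    · rw [eval_mul, eval_lagrangePoly_self hb]; simp
    · intro i _ hij
      rw [eval_mul, eval_lagrangePoly_ne b k hij.symm, mul_zero]
    · simp

theorem sum_lagrangePoly_coeff [IsDomain R] {b : Fin p → R} (hb : Generic b) (k : Fin p → ℤ)
    {n : ℕ} (hn : n < p) (m : ℕ) :
    ∑ i, (-wt b k i) ^ n * (lagrangePoly b k i).coeff m = if m = n then 1 else 0 := by
  have := congrArg (fun P => coeff P m) (sum_lagrangePoly hb k hn)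
  simpa only [finsetSum_coeff, coeff_X_pow, coeff_C_mul] using this

/-- The value at `-x` of the polynomial `1 + ∑ ε_n u^n` with indeterminate coefficients `ε_n`. -/
def charVal (x : R) : MvPowerSeries (Fin p) R :=
  1 + ∑ n : Fin p, MvPowerSeries.X n * MvPowerSeries.C ((-x) ^ (n : ℕ))

theorem constantCoeff_charVal (x : R) :
    MvPowerSeries.constantCoeff (charVal x : MvPowerSeries (Fin p) R) = 1 := by
  simp [charVal]

theorem isUnit_charVal (x : R) : IsUnit (charVal x : MvPowerSeries (Fin p) R) := by
  rw [MvPowerSeries.isUnit_iff_constantCoeff, constantCoeff_charVal]; exact isUnit_one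

/-- The factor of the value of the Whittaker functional at `ξ^(k)` that belongs to `k_i`. -/
def whittakerFactor (b : Fin p → R) (g : Fin (2 * p) → R) (i : Fin p) :
    ℤ → MvPowerSeries (Fin p) R :=
  whittakerCoeff (fun m => MvPowerSeries.C (if 0 ≤ m then 1 else -gammaVal g (-(b i + (m : R)))))
    fun m => charVal (b i + (m : R))

/-- The value of the Whittaker functional at `ξ^(k)`. -/
def whittakerVal (b : Fin p → R) (g : Fin (2 * p) → R) (k : Fin p → ℤ) :
    MvPowerSeries (Fin p) R :=
  ∏ i, whittakerFactor b g i (k i)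

/-- Since `A_i(k)` and the interpolation node depend only on `k_i`, the system of recursions in the
directions `δ_i` decouples and is solved by a product of one-variable solutions. -/
theorem whittakerVal_add (b : Fin p → R) (g : Fin (2 * p) → R) (k : Fin p → ℤ) (i : Fin p) :
    whittakerVal b g (k + Pi.single i 1) * MvPowerSeries.C (coeffA b g k i) =
      charVal (wt b k i) * whittakerVal b g k := by
  have h : whittakerFactor b g i (k i + 1) * MvPowerSeries.C (coeffA b g k i) =
      charVal (wt b k i) * whittakerFactor b g i (k i) :=
    whittakerCoeff_add_one (fun m hm => by rw [if_pos hm, map_one]) (fun m => isUnit_charVal _) _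
  rw [whittakerVal, whittakerVal, ← Finset.mul_prod_erase _ _ (Finset.mem_univ i),
    ← Finset.mul_prod_erase _ (fun j => whittakerFactor b g j (k j)) (Finset.mem_univ i)]
  have h2 : ∏ j ∈ Finset.univ.erase i, whittakerFactor b g j ((k + Pi.single i 1 : Fin p → ℤ) j) =
      ∏ j ∈ Finset.univ.erase i, whittakerFactor b g j (k j) :=
    Finset.prod_congr rfl fun j hj => by simp [Finset.ne_of_mem_erase hj]
  rw [h2, show (k + Pi.single i 1 : Fin p → ℤ) i = k i + 1 by simp]
  linear_combination (∏ j ∈ Finset.univ.erase i, whittakerFactor b g j (k j)) * h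

/-- The Whittaker functional. -/
def whittaker (b : Fin p → R) (g : Fin (2 * p) → R) :
    ((Fin p → ℤ) →₀ R) →ₗ[R] MvPowerSeries (Fin p) R :=
  Finsupp.linearCombination R (whittakerVal b g)

/-- On `ξ^(k)` the recursion replaces `A_i(k) W(k+δ_i)` by `χ(-b_i-k_i) W(k)`. What is left is the
interpolation formula for `χ`, which has degree less than `p`, and its coefficient of `u^n` is
`δ_{n0} + ε_n`. -/
theorem whittaker_op21 [IsDomain R] {b : Fin p → R} (hb : Generic b) (g : Fin (2 * p) → R)
    (n : Fin p) (v : (Fin p → ℤ) →₀ R) :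
    whittaker b g (op21 b g (p - n) v) =
      ((if (n : ℕ) = 0 then 1 else 0) + MvPowerSeries.X n) * whittaker b g v := by
  suffices h : (whittaker b g).comp (op21 b g (p - n)) =
      (LinearMap.mulLeft R ((if (n : ℕ) = 0 then 1 else 0) +
        (MvPowerSeries.X n : MvPowerSeries (Fin p) R))).comp (whittaker b g) from
    LinearMap.congr_fun h v
  refine Finsupp.lhom_ext' fun k => LinearMap.ext_ring ?_
  have e : p - (p - (n : ℕ)) = n := Nat.sub_sub_self n.2.le
  simp only [LinearMap.comp_apply, Finsupp.lsingle_apply, op21, whittaker, map_sum,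
    Finsupp.linearCombination_single, one_smul, LinearMap.mulLeft_apply, e]
  -- The constant term of `χ` carries a factor `(-wt b k i) ^ 0`, so that interpolation of `u^0`
  -- treats it in the same way as the other terms.
  have h1 : ∀ i, (coeffA b g k i * (lagrangePoly b k i).coeff n) •
      whittakerVal b g (k + Pi.single i 1) =
      (MvPowerSeries.C ((-wt b k i) ^ 0 * (lagrangePoly b k i).coeff n) +
        ∑ m : Fin p, MvPowerSeries.X m *
          MvPowerSeries.C ((-wt b k i) ^ (m : ℕ) * (lagrangePoly b k i).coeff n)) *
        whittakerVal b g k := by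
    intro i
    have h := whittakerVal_add b g k i
    have h2 : charVal (wt b k i) * MvPowerSeries.C ((lagrangePoly b k i).coeff n) =
        (MvPowerSeries.C ((-wt b k i) ^ 0 * (lagrangePoly b k i).coeff n) +
        ∑ m : Fin p, MvPowerSeries.X m *
          MvPowerSeries.C ((-wt b k i) ^ (m : ℕ) * (lagrangePoly b k i).coeff n)) := by
      simp only [charVal, add_mul, Finset.sum_mul, map_mul, pow_zero, one_mul, mul_assoc]
    rw [← h2, MvPowerSeries.smul_eq_C_mul, map_mul]
    linear_combination (MvPowerSeries.C ((lagrangePoly b k i).coeff n)) * h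
  rw [Finset.sum_congr rfl fun i _ => h1 i, ← Finset.sum_mul, Finset.sum_add_distrib,
    Finset.sum_comm]
  simp only [← Finset.mul_sum, ← map_sum]
  rw [sum_lagrangePoly_coeff hb k n.pos]
  simp only [sum_lagrangePoly_coeff hb k (Fin.is_lt _)]
  congr 2
  · split_ifs <;> simp
  · rw [Finset.sum_eq_single n]
    · simp
    · intro m _ hm
      rw [if_neg (fun h => hm (Fin.ext h.symm))]; simp
    · simp

end whittaker

/-! ## Algebraic independence and counting -/

section independence

/-- Among the indices of degree at most `n`, the `v i` are independent and lie in the span of as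
many vectors `u i`. A spanning family with as many members as the dimension is independent, and the
two spans coincide. Every finite subfamily lies in such a range, which gives the global statement.
-/
theorem linearIndependent_of_forall_mem_span {K V I : Type*} [Field K] [AddCommGroup V]
    [Module K V] (d : I → ℕ) (hd : ∀ n, {i | d i ≤ n}.Finite) {u v : I → V}
    (hv : LinearIndependent K v) (h : ∀ i, v i ∈ Submodule.span K (u '' {j | d j ≤ d i})) :
    LinearIndependent K u ∧ Submodule.span K (Set.range u) ≤ Submodule.span K (Set.range v) := by
  have key : ∀ n, LinearIndependent K (fun i : {i | d i ≤ n} => u i) ∧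
      Submodule.span K (Set.range fun i : {i | d i ≤ n} => u i) =
        Submodule.span K (Set.range fun i : {i | d i ≤ n} => v i) := by
    intro n
    have := (hd n).fintype
    have hvn : LinearIndependent K (fun i : {i | d i ≤ n} => v i) :=
      hv.comp _ Subtype.val_injective
    have hle : Submodule.span K (Set.range fun i : {i | d i ≤ n} => v i) ≤
        Submodule.span K (Set.range fun i : {i | d i ≤ n} => u i) := by
      refine Submodule.span_le.mpr ?_
      rintro _ ⟨⟨i, hi⟩, rfl⟩
      refine Submodule.span_mono ?_ (h i)
      rintro _ ⟨j, hj, rfl⟩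
      exact ⟨⟨j, Set.mem_ofPred.mpr ((Set.mem_ofPred.mp hj).trans (Set.mem_ofPred.mp hi))⟩, rfl⟩
    have hfin : FiniteDimensional K
        (Submodule.span K (Set.range fun i : {i | d i ≤ n} => u i)) :=
      FiniteDimensional.span_of_finite K (Set.finite_range _)
    have hcard := linearIndependent_iff_card_eq_finrank_span.mp hvn
    have h1 := Submodule.finrank_mono hle
    have h2 := finrank_range_le_card (R := K) (fun i : {i | d i ≤ n} => u i)
    change Fintype.card {i | d i ≤ n} = Module.finrank K (Submodule.span K (Set.range fun i : {i | d i ≤ n} => v i)) at hcard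
    change Module.finrank K (Submodule.span K (Set.range fun i : {i | d i ≤ n} => u i)) ≤ _ at h2
    refine ⟨linearIndependent_iff_card_eq_finrank_span.mpr (le_antisymm ?_ h2), ?_⟩
    · exact hcard.le.trans h1
    · exact (Submodule.eq_of_le_of_finrank_le hle (h2.trans hcard.le)).symm
  constructor
  · rw [linearIndependent_iff_finset_linearIndependent]
    intro s
    refine ((key (s.sup d)).1.comp (fun i : s => ⟨i, Set.mem_ofPred.mpr (Finset.le_sup i.2)⟩) ?_)
    intro i j hij
    exact Subtype.ext (congrArg (fun x : {i | d i ≤ s.sup d} => (x : I)) hij)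
  · refine Submodule.span_le.mpr ?_
    rintro _ ⟨i, rfl⟩
    have h1 : u i ∈ Submodule.span K (Set.range fun j : {j | d j ≤ d i} => u j) :=
      Submodule.subset_span ⟨⟨i, Set.mem_ofPred.mpr le_rfl⟩, rfl⟩
    rw [(key (d i)).2] at h1
    refine Submodule.span_mono ?_ h1
    rintro _ ⟨j, rfl⟩
    exact ⟨j, rfl⟩

theorem prod_map_toList_toMultiset {A M : Type*} [CommMonoid M] (m : A →₀ ℕ) (f : A → M) :
    ((Finsupp.toMultiset m).toList.map f).prod = m.prod fun a n => f a ^ n := by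
  rw [← Multiset.prod_coe, ← Multiset.map_coe, Multiset.coe_toList, Finsupp.toMultiset_map,
    Finsupp.prod_toMultiset, Finsupp.prod_mapDomain_index (by simp) (by simp [pow_add])]

theorem linearIndependent_prod_pow {K A I : Type*} [Field K] [CommRing A] [Algebra K A]
    {x : I → A} (hx : AlgebraicIndependent K x) :
    LinearIndependent K fun m : I →₀ ℕ => m.prod fun i n => x i ^ n := by
  have h := (MvPolynomial.basisMonomials I K).linearIndependent.map'
    (MvPolynomial.aeval x : MvPolynomial I K →ₐ[K] A).toLinearMap
    (LinearMap.ker_eq_bot.mpr hx)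
  have e : (fun m : I →₀ ℕ => m.prod fun i n => x i ^ n) =
      (MvPolynomial.aeval x : MvPolynomial I K →ₐ[K] A).toLinearMap ∘
        MvPolynomial.basisMonomials I K := by
    funext m
    simp [MvPolynomial.aeval_monomial]
  rw [e]; exact h

theorem algebraicIndependent_esymm (K : Type*) [CommRing K] (n : ℕ) :
    AlgebraicIndependent K fun i : Fin n => MvPolynomial.esymm (Fin n) K (i + 1) := by
  intro f f' h
  refine MvPolynomial.esymmAlgHom_injective (σ := Fin n) (n := n) K (by simp) (Subtype.ext ?_)
  rw [MvPolynomial.esymmAlgHom_apply, MvPolynomial.esymmAlgHom_apply]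
  exact h

/-! ### Independence of the eigenvalues of the generators of `Γ` -/

variable (K : Type*) [Field K] (p : ℕ)

/-- The ring homomorphism that sends the variables to the `b_i` and the `g_j`. -/
def iterToGeneric : MvPolynomial (Fin p) (MvPolynomial (Fin (2 * p)) K) →ₐ[K] GenericRing K p :=
  (IsScalarTower.toAlgHom K (ParamRing K p) (GenericRing K p)).comp
    (MvPolynomial.sumAlgEquiv K (Fin p) (Fin (2 * p))).symm.toAlgHom

theorem iterToGeneric_X (i : Fin p) : iterToGeneric K p (MvPolynomial.X i) = varB K p i := by
  simp [iterToGeneric, varB]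

theorem iterToGeneric_C_X (j : Fin (2 * p)) :
    iterToGeneric K p (MvPolynomial.C (MvPolynomial.X j)) = varG K p j := by
  simp [iterToGeneric, varG]

theorem iterToGeneric_injective : Function.Injective (iterToGeneric K p) :=
  (algebraMap_inj K p).comp (MvPolynomial.sumAlgEquiv K (Fin p) (Fin (2 * p))).symm.injective

/-- The eigenvalues on `ξ^(k)` of the `t_{22}^{(r)}` and of the coefficients of the quantum
determinant. -/
def cartanVal (k : Fin p → ℤ) : Fin p ⊕ Fin (2 * p) → GenericRing K p
  | Sum.inl r => (betaPoly (varB K p) k).coeff (p - (r + 1))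
  | Sum.inr s => (∏ j, (X + C (varG K p j))).coeff (2 * p - (s + 1))

/-- At `k = 0` the eigenvalues are the elementary symmetric polynomials in the `b_i` and those in
the `g_j`. -/
theorem algebraicIndependent_cartanVal : AlgebraicIndependent K (cartanVal K p 0) := by
  -- Independence is proved in a tower: in the `g_j` over `K`, then in the `b_i` over the
  -- polynomials in the `g_j`. The iterated polynomial ring serves this purpose.
  have h := ((algebraicIndependent_esymm K (2 * p)).sumElim_comp
    (algebraicIndependent_esymm (MvPolynomial (Fin (2 * p)) K) p)).map'
      (iterToGeneric_injective K p)
  convert h using 1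
  funext z
  rcases z with r | s
  · have h1 : betaPoly (varB K p) 0 =
        (∏ i : Fin p, (X + C (MvPolynomial.X i : MvPolynomial (Fin p)
          (MvPolynomial (Fin (2 * p)) K)))).map (iterToGeneric K p : _ →+* GenericRing K p) := by
      simp [betaPoly, wt, Polynomial.map_prod, iterToGeneric_X]
    simp only [cartanVal, Function.comp_apply, Sum.elim_inl]
    rw [h1, coeff_map, MvPolynomial.prod_X_add_C_coeff _ _ _ (by simp)]
    rw [Fintype.card_fin, Nat.sub_sub_self r.2]
    rfl
  · have h1 : ∏ j, (X + C (varG K p j)) =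
        (∏ i : Fin (2 * p), (X + C (MvPolynomial.X i : MvPolynomial (Fin (2 * p)) K))).map
          ((iterToGeneric K p : MvPolynomial (Fin p) (MvPolynomial (Fin (2 * p)) K) →+*
            GenericRing K p).comp MvPolynomial.C) := by
      simp [Polynomial.map_prod, iterToGeneric_C_X]
    simp only [cartanVal, Function.comp_apply, Sum.elim_inr]
    rw [h1, coeff_map, MvPolynomial.prod_X_add_C_coeff _ _ _ (by simp)]
    rw [Fintype.card_fin, Nat.sub_sub_self s.2]
    rfl

end independence

/-! ## The quantum determinant in the filtrations -/

section determinant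
variable {K : Type*} [Field K] {p : ℕ}

/-- The coefficient of `u^n` has standard degree at most `q - n` and shifted degree at most
`q - n + w`. -/
def CoeffFilt (q w : ℤ) (P : (Yangian K p)[X]) : Prop :=
  ∀ n : ℕ, P.coeff n ∈ filt K p (q - n) (q - n + w)

theorem CoeffFilt.mul {q w q' w' : ℤ} {P Q : (Yangian K p)[X]} (hP : CoeffFilt q w P)
    (hQ : CoeffFilt q' w' Q) : CoeffFilt (q + q') (w + w') (P * Q) := by
  intro n
  rw [coeff_mul]
  refine Submodule.sum_mem _ fun x hx => ?_
  have h : x.1 + x.2 = n := Finset.HasAntidiagonal.mem_antidiagonal.mp hx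
  exact mem_filt_of_le (mul_mem_filt (hP x.1) (hQ x.2)) (by rw [← h]; push_cast; linarith)
    (by rw [← h]; push_cast; linarith)

theorem CoeffFilt.sub {q w : ℤ} {P Q : (Yangian K p)[X]} (hP : CoeffFilt q w P)
    (hQ : CoeffFilt q w Q) : CoeffFilt q w (P - Q) := fun n => by
  rw [coeff_sub]; exact Submodule.sub_mem _ (hP n) (hQ n)

theorem coeffFilt_sum {I : Type*} (s : Finset I) {q w : ℤ} {P : I → (Yangian K p)[X]}
    (hP : ∀ i ∈ s, CoeffFilt q w (P i)) : CoeffFilt q w (∑ i ∈ s, P i) := fun n => by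
  rw [finsetSum_coeff]; exact Submodule.sum_mem _ fun i hi => hP i hi n

theorem coeffFilt_C {q w : ℤ} {x : Yangian K p} (hx : x ∈ filt K p q (q + w)) :
    CoeffFilt q w (C x) := fun n => by
  rw [coeff_C]
  split_ifs with h
  · subst h; exact mem_filt_of_le hx (by simp) (by simp)
  · exact Submodule.zero_mem _

theorem one_mem_filt {e f : ℤ} (he : 0 ≤ e) (hf : 0 ≤ f) : (1 : Yangian K p) ∈ filt K p e f := by
  rw [← map_one (algebraMap K (Yangian K p))]; exact algebraMap_mem_filt 1 he hf

theorem coeffFilt_X : CoeffFilt 1 0 (X : (Yangian K p)[X]) := fun n => by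
  rw [coeff_X]
  split_ifs with h
  · subst h; exact one_mem_filt (by simp) (by simp)
  · exact Submodule.zero_mem _

theorem CoeffFilt.pow {q : ℤ} {P : (Yangian K p)[X]} (hP : CoeffFilt q 0 P) (n : ℕ) :
    CoeffFilt (q * n) 0 (P ^ n) := by
  induction n with
  | zero =>
    rw [pow_zero, ← C_1]
    exact coeffFilt_C (one_mem_filt (by simp) (by simp))
  | succ n ih =>
    have h := ih.mul hP
    rw [pow_succ]
    convert h using 1
    · push_cast; ring
    · simp

theorem T_comp (i j : Fin 2) (P : (Yangian K p)[X]) :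
    (T K p i j).comp P = ∑ r ∈ Finset.range (p + 1), C (t K p i j r) * P ^ (p - r) := by
  rw [T, comp, eval₂_finsetSum]
  exact Finset.sum_congr rfl fun r _ => by
    exact (C_mul_comp (a := t K p i j r) (p := X ^ (p - r)) (r := P)).trans (by rw [X_pow_comp])

/-- The degree `r` of `t_{ij}^{(r)}` and the degree `p - r` of the power of `P` add up to `p` in
every term. Both `u` and `u - 1` qualify as `P`, so the shift of argument in the quantum determinant
does no harm. -/
theorem coeffFilt_T_comp (i j : Fin 2) {P : (Yangian K p)[X]} (hP : CoeffFilt 1 0 P) :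
    CoeffFilt p (p * ((j : ℕ) - (i : ℕ))) ((T K p i j).comp P) := by
  rw [T_comp]
  refine coeffFilt_sum _ fun r hr => ?_
  have hr' : r ≤ p := Nat.lt_succ_iff.mp (Finset.mem_range.mp hr)
  have h := (coeffFilt_C (q := r) (w := p * ((j : ℕ) - (i : ℕ))) (t_mem_filt i j r)).mul
    (hP.pow (p - r))
  convert h using 1
  · push_cast [hr']; ring
  · ring

/-- The shifts `-p` of `T_{21}` and `p` of `T_{12}` cancel, and `T_{11}` and `T_{22}` have none. The
coefficient of `u^(2p-s)` therefore has both degrees at most `s`. -/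
theorem coeffFilt_qdet : CoeffFilt (2 * p) 0 (qdet K p) := by
  have hX : CoeffFilt 1 0 (X - 1 : (Yangian K p)[X]) :=
    coeffFilt_X.sub (by rw [← C_1]; exact coeffFilt_C (one_mem_filt (by simp) (by simp)))
  have hT : ∀ i j : Fin 2, CoeffFilt p (p * ((j : ℕ) - (i : ℕ))) (T K p i j) := fun i j => by
    simpa using coeffFilt_T_comp (K := K) (p := p) i j coeffFilt_X
  have h1 := (hT 0 0).mul (coeffFilt_T_comp 1 1 hX)
  have h2 := (hT 1 0).mul (coeffFilt_T_comp 0 1 hX)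
  rw [qdet]
  refine CoeffFilt.sub ?_ ?_
  · convert h1 using 1
    · ring
    · simp
  · convert h2 using 1
    · ring
    · simp

variable (K) in
/-- The elements `t_{22}^{(r)}` and the coefficients of the quantum determinant. -/
def cartanGen : Fin p ⊕ Fin (2 * p) → Yangian K p
  | Sum.inl r => t K p 1 1 (r + 1)
  | Sum.inr s => (qdet K p).coeff (2 * p - (s + 1))

variable (K) in
/-- The monomials in these elements. -/
def cartanMon (m : Fin p ⊕ Fin (2 * p) →₀ ℕ) : Yangian K p :=
  ((Finsupp.toMultiset m).toList.map (cartanGen K)).prod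

theorem cartanGen_mem_filt (z : Fin p ⊕ Fin (2 * p)) :
    cartanGen K z ∈ filt K p (cartanDeg z) (cartanDeg z) := by
  rcases z with r | s
  · have h := t_mem_filt (K := K) (p := p) 1 1 (r + 1)
    simpa [cartanDeg, cartanGen] using h
  · have h := coeffFilt_qdet (K := K) (p := p) (2 * p - (s + 1))
    refine mem_filt_of_le h ?_ ?_ <;> simp only [cartanDeg] <;> omega

theorem cartanMon_mem_filt (m : Fin p ⊕ Fin (2 * p) →₀ ℕ) :
    cartanMon K m ∈ filt K p (Finsupp.weight cartanDeg m : ℕ) (Finsupp.weight cartanDeg m : ℕ) := by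
  have h : ∀ l : List (Fin p ⊕ Fin (2 * p)), (l.map (cartanGen K)).prod ∈
      filt K p ((l.map cartanDeg).sum : ℕ) ((l.map cartanDeg).sum : ℕ) := by
    intro l
    induction l with
    | nil => exact one_mem_filt (by simp) (by simp)
    | cons z l ih =>
      simp only [List.map_cons, List.prod_cons, List.sum_cons, Nat.cast_add]
      exact mul_mem_filt (cartanGen_mem_filt z) ih
  have := h (Finsupp.toMultiset m).toList
  rw [sum_map_toList_toMultiset] at this
  rwa [Finsupp.weight_apply]

theorem cartanGen_mem_Gamma (z : Fin p ⊕ Fin (2 * p)) : cartanGen K z ∈ Gamma K p := by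
  rcases z with r | s
  · exact Algebra.subset_adjoin (Or.inr ⟨r + 1, by omega, by omega, rfl⟩)
  · exact Algebra.subset_adjoin (Or.inl ⟨_, rfl⟩)

theorem cartanMon_mem_Gamma (m : Fin p ⊕ Fin (2 * p) →₀ ℕ) : cartanMon K m ∈ Gamma K p := by
  refine Subalgebra.list_prod_mem _ ?_
  intro x hx
  obtain ⟨z, -, rfl⟩ := List.mem_map.mp hx
  exact cartanGen_mem_Gamma z

end determinant

/-! ## The universal representation -/

section representation
variable (K : Type*) [Field K] [CharZero K] (p : ℕ)

/-! ### The matrices of the elements of `Γ` -/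

theorem universalRep_sub_apply (x y : Yangian K p) (v : (Fin p → ℤ) →₀ GenericRing K p) :
    universalRep K p (x - y) v = universalRep K p x v - universalRep K p y v := by
  rw [eq_sub_iff_add_eq, ← LinearMap.add_apply, ← map_add, sub_add_cancel]

theorem universalRep_t22 {r : ℕ} (hr : r ≤ p) : universalRep K p (t K p 1 1 r) =
    diagOp fun k => (betaPoly (varB K p) k).coeff (p - r) := by
  rw [universalRep_t, opT, if_neg (by omega)]
  rfl

omit [CharZero K] in
theorem eval_T_comp (i j : Fin 2) (P : (Yangian K p)[X]) (u v : ℤ)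
    (hP : ∀ n : ℕ, (P ^ n).eval (u : Yangian K p) = (v : Yangian K p) ^ n) :
    ((T K p i j).comp P).eval (u : Yangian K p) =
      ∑ a ∈ Finset.range (p + 1), (v ^ a) • t K p i j (p - a) := by
  rw [T_comp, eval_finsetSum, ← Finset.sum_range_reflect]
  refine Finset.sum_congr rfl fun a ha => ?_
  have ha' : a ≤ p := Nat.lt_succ_iff.mp (Finset.mem_range.mp ha)
  rw [eval_C_mul, hP, show p + 1 - 1 - a = p - a by omega, Nat.sub_sub_self ha', zsmul_eq_mul,
    Int.cast_pow, ((Int.cast_commute v _).pow_left a).eq]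

-- Evaluation of polynomials with noncommuting coefficients is multiplicative at central points, in
-- particular at integers. Integer values are enough to recover operator coefficients, by
-- `end_extract`.
omit [CharZero K] in
theorem eval_qdet (u : ℤ) : (qdet K p).eval (u : Yangian K p) =
    (∑ a ∈ Finset.range (p + 1), (u ^ a) • t K p 0 0 (p - a)) *
        (∑ a ∈ Finset.range (p + 1), ((u - 1) ^ a) • t K p 1 1 (p - a)) -
      (∑ a ∈ Finset.range (p + 1), (u ^ a) • t K p 1 0 (p - a)) *
        (∑ a ∈ Finset.range (p + 1), ((u - 1) ^ a) • t K p 0 1 (p - a)) := by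
  have hmul : ∀ P Q : (Yangian K p)[X], (P * Q).eval (u : Yangian K p) =
      P.eval (u : Yangian K p) * Q.eval (u : Yangian K p) := fun P Q =>
    eval₂_mul_noncomm _ _ fun k => Int.commute_cast _ _
  have hX : ∀ n : ℕ, ((X : (Yangian K p)[X]) ^ n).eval (u : Yangian K p) =
      (u : Yangian K p) ^ n := fun n => by
    induction n with
    | zero => simp
    | succ n ih => rw [pow_succ, hmul, ih, pow_succ, eval_X]
  have hX1 : ∀ n : ℕ, ((X - 1 : (Yangian K p)[X]) ^ n).eval (u : Yangian K p) =
      ((u - 1 : ℤ) : Yangian K p) ^ n := fun n => by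
    induction n with
    | zero => simp
    | succ n ih => rw [pow_succ, hmul, ih, pow_succ]; simp
  have hT : ∀ i j, (T K p i j).eval (u : Yangian K p) =
      ∑ a ∈ Finset.range (p + 1), (u ^ a) • t K p i j (p - a) := fun i j => by
    simpa using eval_T_comp K p i j X u u hX
  rw [qdet, eval_sub, hmul, hmul, hT, hT, eval_T_comp K p 1 1 _ u _ hX1,
    eval_T_comp K p 0 1 _ u _ hX1]

theorem eq_of_sum_pow_smul_eq {A : Type*} [Ring A]
    (hex : ∀ (n : ℕ) (x : ℕ → A), (∀ u : ℤ, ∑ a ∈ Finset.range n, (u ^ a) • x a = 0) →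
      ∀ a < n, x a = 0) {n : ℕ} {x y : ℕ → A}
    (h : ∀ u : ℤ, ∑ a ∈ Finset.range n, (u ^ a) • x a = ∑ a ∈ Finset.range n, (u ^ a) • y a)
    {a : ℕ} (ha : a < n) : x a = y a := by
  refine sub_eq_zero.mp (hex n (fun a => x a - y a) (fun u => ?_) a ha)
  simp only [smul_sub]
  rw [Finset.sum_sub_distrib, h, sub_self]

theorem universalRep_qdet_coeff (n : ℕ) : universalRep K p ((qdet K p).coeff n) =
    diagOp fun _ => (∏ j, (X + C (varG K p j))).coeff n := by
  let G : (GenericRing K p)[X] := ∏ j, (X + C (varG K p j))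
  have hG : ∀ u : ℤ, G.eval (u : GenericRing K p) = gammaVal (varG K p) u := fun u => by
    simp [G, eval_prod, gammaVal]
  have hdiag : ∀ c : GenericRing K p, (diagOp fun _ => c : LatticeEnd (GenericRing K p) p) =
      c • 1 := fun c => end_ext fun k => by simp [diagOp_single]
  -- `N` exceeds both degrees, so that both evaluations are sums over one range, and it exceeds `n`,
  -- so that the coefficient in question occurs.
  let N := max (max (qdet K p).natDegree G.natDegree) n + 1
  rw [hdiag]
  refine eq_of_sum_pow_smul_eq (A := LatticeEnd (GenericRing K p) p) end_extract (n := N)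
    (x := fun a => universalRep K p ((qdet K p).coeff a))
    (y := fun a => G.coeff a • 1) (fun u => ?_) (by omega)
  have h1 := congrArg (universalRep K p) (eval_qdet K p u)
  simp only [map_sub, map_mul, map_sum, map_zsmul, universalRep_t] at h1
  rw [opT_qdet (varB_generic K p), ← hG, eval_eq_sum_range' (n := N) (by omega),
    eval_eq_sum_range' (n := N) (by omega), map_sum, Finset.sum_smul] at h1
  have h2 : ∀ a, (u ^ a) • universalRep K p ((qdet K p).coeff a) =
      universalRep K p ((qdet K p).coeff a * (u : Yangian K p) ^ a) := fun a => by
    rw [← Int.cast_pow, ← (Int.cast_commute (u ^ a) _).eq, ← zsmul_eq_mul, map_zsmul]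
  have h3 : ∀ a, (u ^ a) • (G.coeff a • (1 : LatticeEnd (GenericRing K p) p)) =
      (G.coeff a * (u : GenericRing K p) ^ a) • (1 : LatticeEnd (GenericRing K p) p) := fun a =>
    end_ext fun k => by ext; simp [mul_comm]
  rw [Finset.sum_congr rfl fun a _ => h2 a, Finset.sum_congr rfl fun a _ => h3 a]
  exact h1

theorem universalRep_cartanGen (z : Fin p ⊕ Fin (2 * p)) :
    universalRep K p (cartanGen K z) = diagOp fun k => cartanVal K p k z := by
  rcases z with r | s
  · exact universalRep_t22 K p (by omega)
  · exact universalRep_qdet_coeff K p _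

theorem universalRep_cartanMon (m : Fin p ⊕ Fin (2 * p) →₀ ℕ) : universalRep K p (cartanMon K m) =
    diagOp fun k => m.prod fun z n => cartanVal K p k z ^ n := by
  have h : ∀ l : List (Fin p ⊕ Fin (2 * p)),
      universalRep K p (l.map (cartanGen K)).prod =
        diagOp fun k => (l.map (cartanVal K p k)).prod := by
    intro l
    induction l with
    | nil => rw [List.map_nil, List.prod_nil, map_one]
             exact end_ext fun k => by simp [diagOp_single]
    | cons z l ih =>
      rw [List.map_cons, List.prod_cons, map_mul, ih, universalRep_cartanGen, diag_mul_diag]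
      simp
  rw [cartanMon, h]
  congr 1; funext k
  exact prod_map_toList_toMultiset m _

theorem exists_diagOp {x : Yangian K p} (hx : x ∈ Gamma K p) :
    ∃ f, universalRep K p x = diagOp f := by
  induction hx using Algebra.adjoin_induction with
  | mem x hx =>
    rcases hx with ⟨n, rfl⟩ | ⟨r, -, hr, rfl⟩
    · exact ⟨_, universalRep_qdet_coeff K p n⟩
    · exact ⟨_, universalRep_t22 K p hr⟩
  | algebraMap c =>
    refine ⟨fun _ => algebraMap K _ c, end_ext fun k => ?_⟩
    rw [AlgHom.commutes, diagOp_single, one_mul, Module.algebraMap_end_apply,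
      Finsupp.smul_single, Algebra.algebraMap_eq_smul_one]
  | add x y _ _ hx hy =>
    obtain ⟨f, hf⟩ := hx
    obtain ⟨f', hf'⟩ := hy
    refine ⟨f + f', end_ext fun k => ?_⟩
    rw [map_add, hf, hf', LinearMap.add_apply]
    simp [diagOp_single]
  | mul x y _ _ hx hy =>
    obtain ⟨f, hf⟩ := hx
    obtain ⟨f', hf'⟩ := hy
    exact ⟨_, by rw [map_mul, hf, hf', diag_mul_diag]⟩

/-! ### Rows of the Whittaker functional -/

/-- The coefficient at `ε^α` of the Whittaker functional applied to `G(x) ξ^(k)`. -/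
def whittakerRow (α : Fin p →₀ ℕ) :
    Yangian K p →ₗ[K] ((Fin p → ℤ) → GenericRing K p) where
  toFun x k := MvPowerSeries.coeff α
    (whittaker (varB K p) (varG K p) (universalRep K p x (Finsupp.single k 1)))
  map_add' x y := by funext k; simp
  map_smul' c x := by
    funext k
    rw [map_smul, LinearMap.smul_apply,
      algebra_compatible_smul (GenericRing K p) c (universalRep K p x (Finsupp.single k 1)),
      map_smul, map_smul, RingHom.id_apply, Pi.smul_apply, algebraMap_smul]

variable {K p}

theorem whittaker_gen_mul (n : Fin p) (x : Yangian K p) (v : (Fin p → ℤ) →₀ GenericRing K p) :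
    whittaker (varB K p) (varG K p) (universalRep K p (gen K p (Sum.inl n) * x) v) =
      MvPowerSeries.X n * whittaker (varB K p) (varG K p) (universalRep K p x v) := by
  have h1 : universalRep K p (t K p 1 0 (p - n)) = op21 (varB K p) (varG K p) (p - n) := by
    rw [universalRep_t, opT, if_neg (by omega)]; rfl
  rw [gen, map_mul, map_sub, h1, AlgHom.commutes, Module.End.mul_apply, LinearMap.sub_apply,
    map_sub, whittaker_op21 (varB_generic K p), Module.algebraMap_end_apply]
  split_ifs <;> simp [add_mul]

theorem whittaker_lowerMon_mul (α : Fin p →₀ ℕ) (x : Yangian K p)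
    (v : (Fin p → ℤ) →₀ GenericRing K p) :
    whittaker (varB K p) (varG K p) (universalRep K p (lowerMon K α * x) v) =
      MvPowerSeries.monomial α 1 * whittaker (varB K p) (varG K p) (universalRep K p x v) := by
  rw [MvPowerSeries.monomial_one_eq, ← prod_map_toList_toMultiset, lowerMon]
  induction (Finsupp.toMultiset α).toList with
  | nil => simp
  | cons n l ih =>
    rw [List.map_cons, List.prod_cons, mul_assoc, whittaker_gen_mul, ih]
    simp [mul_assoc]

/-- Under the functional, lower monomials placed on the left are multiplication by `ε^β`, which only
shifts coefficients. This is why sorting puts them on the left. -/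
theorem whittakerRow_lowerMon_mul (α β : Fin p →₀ ℕ) (x : Yangian K p) :
    whittakerRow K p α (lowerMon K β * x) =
      if β ≤ α then whittakerRow K p (α - β) x else 0 := by
  funext k
  change MvPowerSeries.coeff α (whittaker _ _ _) = _
  rw [whittaker_lowerMon_mul, MvPowerSeries.coeff_monomial_mul]
  split_ifs
  · rw [one_mul]; rfl
  · rfl

theorem gammaVal_ne_zero (i : Fin p) (m : ℤ) :
    gammaVal (varG K p) (-(varB K p i + (m : GenericRing K p))) ≠ 0 := by
  rw [gammaVal, Finset.prod_ne_zero_iff]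
  intro j _ h
  have h1 : algebraMap (ParamRing K p) (GenericRing K p)
      (-(MvPolynomial.X (Sum.inl i) + MvPolynomial.C (m : K)) + MvPolynomial.X (Sum.inr j)) = 0 := by
    rw [← h]; simp [varB, varG]
  rw [map_eq_zero_iff _ (algebraMap_inj K p)] at h1
  -- At `b = 0` and `g = m + 1` the factor `-(b_i + m) + g_j` takes the value `1`.
  have := congrArg (MvPolynomial.eval (Sum.elim (fun _ => 0) (fun _ => (m : K) + 1))) h1
  simp at this

theorem constantCoeff_whittakerVal_ne_zero (k : Fin p → ℤ) :
    MvPowerSeries.constantCoeff (whittakerVal (varB K p) (varG K p) k) ≠ 0 := by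
  rw [whittakerVal, map_prod, Finset.prod_ne_zero_iff]
  intro i _
  refine map_whittakerCoeff _ (fun m => constantCoeff_charVal _) (fun m => isUnit_charVal _) ?_ _
  intro m
  rw [MvPowerSeries.constantCoeff_C]
  split_ifs
  · exact one_ne_zero
  · exact neg_ne_zero.mpr (gammaVal_ne_zero i m)

theorem whittakerRow_zero_of_single {x : Yangian K p} {k : Fin p → ℤ} {c : GenericRing K p}
    (h : universalRep K p x (Finsupp.single k 1) = Finsupp.single k c) :
    whittakerRow K p 0 x k =
      c * MvPowerSeries.constantCoeff (whittakerVal (varB K p) (varG K p) k) := by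
  change MvPowerSeries.coeff 0 (whittaker _ _ _) = _
  rw [h, whittaker, Finsupp.linearCombination_single, map_smul, smul_eq_mul,
    MvPowerSeries.coeff_zero_eq_constantCoeff_apply]

theorem linearIndependent_whittakerRow_cartanMon :
    LinearIndependent K fun m => whittakerRow K p 0 (cartanMon K m) := by
  -- It is enough to look at `k = 0`, where the Whittaker value is an empty product, so the row
  -- entry is the eigenvalue itself.
  refine LinearIndependent.of_comp (LinearMap.proj (R := K) (φ := fun _ => GenericRing K p)
    (0 : Fin p → ℤ)) ?_
  have h := linearIndependent_prod_pow (algebraicIndependent_cartanVal K p)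
  have e : (LinearMap.proj (R := K) (φ := fun _ => GenericRing K p) (0 : Fin p → ℤ)) ∘
      (fun m => whittakerRow K p 0 (cartanMon K m)) =
      fun m => m.prod fun z n => cartanVal K p 0 z ^ n := by
    funext m
    have h0 : whittakerVal (varB K p) (varG K p) 0 = 1 := Finset.prod_eq_one fun i _ => rfl
    rw [Function.comp_apply, LinearMap.proj_apply, whittakerRow_zero_of_single
      (by rw [universalRep_cartanMon, diagOp_single]), h0]
    simp
  rw [e]; exact h

/-- The row `0` annihilates the sorted words with a lower factor, and for the remaining ones the
shifted degree bounds the weight. -/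
theorem whittakerRow_zero_mem_span {x : Yangian K p} {e : ℤ} {f : ℕ} (hx : x ∈ filt K p e f) :
    whittakerRow K p 0 x ∈ Submodule.span K ((fun m => whittakerRow K p 0 (upperMon K m)) ''
      {m | Finsupp.weight cartanDeg m ≤ f}) := by
  have h := Submodule.mem_map_of_mem (f := whittakerRow K p 0) (filt_le_span e f hx)
  refine Submodule.map_span_le _ _ _ |>.mpr ?_ h
  rintro _ ⟨α, m, h1, rfl⟩
  rw [whittakerRow_lowerMon_mul]
  split_ifs with hα
  · have hα0 : α = 0 := le_antisymm hα zero_le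
    subst hα0
    rw [tsub_zero]
    exact Submodule.subset_span ⟨m, Set.mem_ofPred.mpr (by exact_mod_cast h1 rfl), rfl⟩
  · exact Submodule.zero_mem _

/-- This is the dimension count: monomials in the generators of `Γ` and upper monomials have the
same exponents and weights, and the rows of the former are independent and lie in the span of rows
of the latter of no larger weight. -/
theorem whittakerRow_upperMon :
    LinearIndependent K (fun m => whittakerRow K p 0 (upperMon K m)) ∧
      Submodule.span K (Set.range fun m => whittakerRow K p 0 (upperMon K m)) ≤
        Submodule.span K (Set.range fun m => whittakerRow K p 0 (cartanMon K m)) := by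
  refine linearIndependent_of_forall_mem_span
    (fun m : Fin p ⊕ Fin (2 * p) →₀ ℕ => Finsupp.weight cartanDeg m) ?_
    linearIndependent_whittakerRow_cartanMon
    fun m => whittakerRow_zero_mem_span (cartanMon_mem_filt m)
  intro n
  -- All generators have positive weight, so there are finitely many monomials up to each weight.
  refine Finsupp.finite_of_nat_weight_le _ ?_ n
  rintro (r | s) <;> simp [cartanDeg]

/-! ### From rows back to the Yangian: faithfulness, diagonal matrices, maximality -/

theorem exists_mem_Gamma_whittakerRow_eq (x : Yangian K p) :
    ∃ z ∈ Gamma K p, whittakerRow K p 0 x = whittakerRow K p 0 z := by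
  obtain ⟨n, hn⟩ := exists_mem_filt x
  have h1 := Submodule.span_mono (Set.image_subset_range _ _) (whittakerRow_zero_mem_span hn)
  have h2 := whittakerRow_upperMon.2 h1
  have h3 : Submodule.span K (Set.range fun m => whittakerRow K p 0 (cartanMon K m)) ≤
      (Subalgebra.toSubmodule (Gamma K p)).map (whittakerRow K p 0) := by
    refine Submodule.span_le.mpr ?_
    rintro _ ⟨m, rfl⟩
    exact ⟨_, cartanMon_mem_Gamma m, rfl⟩
  obtain ⟨z, hz, h4⟩ := h3 h2
  exact ⟨z, hz, h4.symm⟩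

/-- The row `α` of a sorted expansion involves only lower exponents `β ≤ α`. For `α` minimal among
those that occur it is a combination of the independent rows of the upper monomials, so the
coefficients at `α` vanish. The argument also shows that the sorted words are linearly independent.
-/
theorem universalRep_injective : Function.Injective (universalRep K p) := by
  rw [injective_iff_map_eq_zero]
  intro x hx
  have hrow : ∀ α, whittakerRow K p α x = 0 := fun α => by
    funext k
    change MvPowerSeries.coeff α (whittaker _ _ _) = 0
    rw [hx, LinearMap.zero_apply, map_zero, map_zero]
  obtain ⟨n, hn⟩ := exists_mem_filt x
  have hspan : x ∈ Submodule.span K (Set.range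
      fun i : (Fin p →₀ ℕ) × (Fin p ⊕ Fin (2 * p) →₀ ℕ) => lowerMon K i.1 * upperMon K i.2) := by
    refine Submodule.span_mono ?_ (filt_le_span _ _ hn)
    rintro _ ⟨α, m, -, rfl⟩
    exact ⟨(α, m), rfl⟩
  obtain ⟨c, rfl⟩ := (Finsupp.mem_span_range_iff_exists_finsupp).mp hspan
  suffices hc : c = 0 by rw [hc, Finsupp.sum_zero_index]
  by_contra hc
  have hne : (c.support.image Prod.fst).Nonempty :=
    (Finsupp.support_nonempty_iff.mpr hc).image _
  obtain ⟨α, hα, hmin⟩ := (c.support.image Prod.fst).exists_minimal hne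
  have h1 := hrow α
  -- The support is enlarged to a product of its two projections, so that the sum over the lower
  -- exponent separates from the sum over the upper one; the added terms have coefficient `0`.
  rw [Finsupp.sum, map_sum, Finset.sum_subset (Finset.subset_product (s := c.support))] at h1
  · rw [Finset.sum_product, Finset.sum_eq_single_of_mem α hα] at h1
    · simp only [map_smul, whittakerRow_lowerMon_mul, le_refl, if_true, tsub_self] at h1
      have h2 := linearIndependent_iff'.mp (whittakerRow_upperMon (K := K) (p := p)).1 _ _ h1
      obtain ⟨⟨β, m⟩, hm, hβ⟩ := Finset.mem_image.mp hα
      simp only at hβ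
      subst hβ
      exact Finsupp.mem_support_iff.mp hm (h2 m (Finset.mem_image_of_mem Prod.snd hm))
    · intro β hβ hne
      refine Finset.sum_eq_zero fun m _ => ?_
      rw [map_smul, whittakerRow_lowerMon_mul, if_neg, smul_zero]
      intro hle
      exact hne (le_antisymm hle (hmin hβ hle))
  · intro i _ hi
    rw [Finsupp.notMem_support_iff.mp hi, zero_smul, map_zero]

/-- Subtract the element of `Γ` with the same row `0`. The difference still has a diagonal matrix,
and its row `0` is the diagonal entry times the constant term of the Whittaker value. That constant
term is nonzero, so the matrix vanishes and faithfulness applies. -/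
theorem mem_Gamma_of_diag {x : Yangian K p}
    (hx : ∀ k k', k' ≠ k → universalRep K p x (Finsupp.single k 1) k' = 0) : x ∈ Gamma K p := by
  obtain ⟨z, hz, hxz⟩ := exists_mem_Gamma_whittakerRow_eq x
  suffices h : x = z by rwa [h]
  apply universalRep_injective
  obtain ⟨f, hf⟩ := exists_diagOp K p hz
  apply end_ext
  intro k
  rw [← sub_eq_zero, ← universalRep_sub_apply]
  have h1 : universalRep K p (x - z) (Finsupp.single k 1) = Finsupp.single k
      (universalRep K p (x - z) (Finsupp.single k 1) k) := by
    ext k'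
    by_cases h : k' = k
    · subst h; simp
    · rw [Finsupp.single_eq_of_ne h, universalRep_sub_apply, hf, Finsupp.sub_apply,
        hx k k' h, diagOp_single, Finsupp.single_eq_of_ne h, sub_zero]
  have h2 := whittakerRow_zero_of_single h1
  rw [map_sub, hxz, sub_self, Pi.zero_apply, eq_comm, mul_eq_zero] at h2
  rw [h1, h2.resolve_right (constantCoeff_whittakerVal_ne_zero k), Finsupp.single_zero]

theorem Gamma_comm {x y : Yangian K p} (hx : x ∈ Gamma K p) (hy : y ∈ Gamma K p) :
    x * y = y * x := by
  apply universalRep_injective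
  obtain ⟨f, hf⟩ := exists_diagOp K p hx
  obtain ⟨f', hf'⟩ := exists_diagOp K p hy
  rw [map_mul, map_mul, hf, hf', diag_mul_diag, diag_mul_diag]
  simp only [mul_comm]

/-- The root `-b_i-k_i` of one product must equal some `-b_j-k'_j`. For `j ≠ i` this contradicts
genericity, because `b_j - b_i` plus an integer is a unit; hence `j = i` and `k_i = k'_i`. -/
theorem betaPoly_injective {R : Type*} [CommRing R] [IsDomain R] [CharZero R] {b : Fin p → R}
    (hb : Generic b) : Function.Injective (betaPoly b) := by
  intro k k' h
  funext i
  have h1 := congrArg (eval (-wt b k i)) h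
  simp only [betaPoly, eval_prod, eval_add, eval_X, eval_C] at h1
  rw [Finset.prod_eq_zero (Finset.mem_univ i) (by simp), eq_comm, Finset.prod_eq_zero_iff] at h1
  obtain ⟨j, -, hj⟩ := h1
  by_cases hij : j = i
  · subst hij
    simp only [wt] at hj
    have h2 : (k' j : R) = k j := by linear_combination hj
    exact (Int.cast_injective h2).symm
  · have h2 := hb j i hij (k' j - k i)
    refine absurd h2 ?_
    rw [show b j - b i + ((k' j - k i : ℤ) : R) = 0 by
      simp only [wt] at hj; push_cast; linear_combination hj]
    exact not_isUnit_zero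

theorem mem_Gamma_of_commute {x : Yangian K p} (hx : ∀ z ∈ Gamma K p, x * z = z * x) :
    x ∈ Gamma K p := by
  refine mem_Gamma_of_diag fun k k' hk => ?_
  by_contra h0
  refine hk (betaPoly_injective (varB_generic K p) ?_)
  have hcoeff : ∀ r ≤ p, (betaPoly (varB K p) k').coeff (p - r) =
      (betaPoly (varB K p) k).coeff (p - r) := by
    intro r hr
    have hz : t K p 1 1 r ∈ Gamma K p := by
      rcases Nat.eq_zero_or_pos r with rfl | h
      · rw [t_zero]; exact Subalgebra.algebraMap_mem _ _
      · exact Algebra.subset_adjoin (Or.inr ⟨r, h, hr, rfl⟩)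
    -- Comparing the entries at `(k', k)`, the nonzero entry of `x` is multiplied by the eigenvalue
    -- at `k` on one side and by that at `k'` on the other, so the two eigenvalues agree.
    have h1 := congrArg (universalRep K p) (hx _ hz)
    rw [map_mul, map_mul, universalRep_t22 K p hr] at h1
    have h2 := DFunLike.congr_fun (LinearMap.congr_fun h1 (Finsupp.single k 1)) k'
    have hdiag : ∀ (f : (Fin p → ℤ) → GenericRing K p) (v : (Fin p → ℤ) →₀ GenericRing K p),
        diagOp f v k' = v k' * f k' := by
      intro f v
      induction v using Finsupp.induction_linear with
      | zero => simp
      | add v w hv hw => rw [map_add, Finsupp.add_apply, hv, hw, Finsupp.add_apply, add_mul]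
      | single a c =>
        rw [diagOp_single]
        by_cases h : k' = a
        · subst h; simp
        · simp [Finsupp.single_eq_of_ne h]
    rw [Module.End.mul_apply, Module.End.mul_apply, hdiag, diagOp_single, one_mul,
      ← mul_one ((betaPoly (varB K p) k).coeff (p - r)), ← smul_eq_mul, ← Finsupp.smul_single,
      map_smul, Finsupp.smul_apply, smul_eq_mul, mul_comm] at h2
    exact (mul_left_cancel₀ h0 h2).symm
  ext n
  by_cases hn : n ≤ p
  · have := hcoeff (p - n) (Nat.sub_le _ _)
    rwa [Nat.sub_sub_self hn] at this
  · have hdeg : ∀ k, (betaPoly (varB K p) k).natDegree ≤ p := fun k => by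
      refine (natDegree_prod_le _ _).trans ?_
      refine (Finset.sum_le_card_nsmul _ _ 1 fun j _ => ?_).trans (by simp)
      compute_degree
    rw [coeff_eq_zero_of_natDegree_lt ((hdeg k').trans_lt (not_le.mp hn)),
      coeff_eq_zero_of_natDegree_lt ((hdeg k).trans_lt (not_le.mp hn))]

end representation

end LevelYangian

end

theorem corollary5 (K : Type*) [Field K] [IsAlgClosed K] [CharZero K] (p : ℕ) (hp : 0 < p) :
    Maximal (fun A : Subalgebra K (LevelYangian.Yangian K p) => ∀ x ∈ A, ∀ y ∈ A, x * y = y * x)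
      (LevelYangian.Gamma K p) ∧
    Function.Injective (LevelYangian.universalRep K p) ∧
    ∀ x : LevelYangian.Yangian K p,
      (LevelYangian.universalMatrix K p x).IsDiag → x ∈ LevelYangian.Gamma K p := by
  refine ⟨⟨fun x hx y hy => LevelYangian.Gamma_comm hx hy, fun A hA hle x hx => ?_⟩,
    LevelYangian.universalRep_injective, fun x hx => ?_⟩
  -- A commutative subalgebra containing `Γ` lies in the centralizer of `Γ`, which is contained in
  -- `Γ`.
  · exact LevelYangian.mem_Gamma_of_commute fun z hz => hA x hx z (hle hz)
  · exact LevelYangian.mem_Gamma_of_diag fun k k' hk => hx hk
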